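/- **Theorem 5.1.** Let $X>0$, $n\in\mathbb N$, $\lambda\in\mathbb C$, and let $A_0,A_1,B_0$ be $X$-periodic $\mathbb C^{n\times n}$-valued functions on $\mathbb R$ with entries in $L^2(0,X)$. Consider the equation $\big(\partial_x^2+\partial_xA_1+A_0-\lambda B_0\big)U=0$, where $\partial_xA_1$ acts by $U\mapsto\partial_x(A_1U)$, and the matrix functions $$\mathcal A=\begin{pmatrix}0&I\\ \lambda B_0-A_0-\partial_xA_1&-A_1\end{pmatrix},\qquad \mathcal A^{q}=\begin{pmatrix}-A_1&I\\ \lambda B_0-A_0&0\end{pmatrix},$$ with $\partial_xA_1$ the distributional derivative of the function $A_1$; they are the coefficients of the first-order systems equivalent to the equation for $W=(U,\partial_xU)$ and $W=(U,\partial_xU+A_1U)$ respectively. For a $2n\times 2n$ matrix function $M$ with entries in $L^2(0,X)$, let $\mathcal K_M=(\partial_x-1)^{-1}(M-1)$ on $L^2([0,X];\mathbb C^{2n})$, where $(\partial_x-1)^{-1}$ is taken with periodic boundary conditions; that is, $u=\mathcal K_Mf$ is the absolutely continuous function with $u'-u=(M-1)f$ a.e. and $u(0)=u(X)$. Let $\Psi_M$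 be the absolutely continuous solution on $[0,X]$ of $\Psi'=M\Psi$ a.e., $\Psi(0)=I$, and put $$E_M=\det(\Psi_M(X)-I),\qquad \gamma_M=\exp\Big(\frac{e^X}{1-e^X}\int_0^X(\operatorname{tr}M(y)-2n)\,dy\Big).$$ For a Hilbert–Schmidt operator $K$, ${\det}_2(I-K)$ is the limit of $\det(I-K_J)\,e^{\operatorname{tr}K_J}$, where $K_J$ is the Galerkin approximation of $K$ (compression by the orthogonal projection) on the $J$-th member of an increasing sequence of finite-dimensional subspaces with dense union; that this limit exists and does not depend on the sequence, in the cases below, is part of the claim. 1. Suppose that $\partial_xA_1$ is (represented by) an $L^2(0,X)$ periodic function. Then $\mathcal K_{\mathcal A}$ exists as a bounded operator and is unique, $\Psi_{\mathcal A}$ exists, $\mathcal K_{\mathcal A}$ is Hilbert–Schmidt, and $F(\lambda)={\det}_2(I-\mathcal K_{\mathcal A})$ and $E(\lambda)=E_{\mathcal A}$ satisfy $$F(\lambda)=\gamma\,(e^X-1)^{-2n}E(\lambda),\qquad \gamma=\gamma_{\mathcal A}=\exp\Big(\frac{e^X}{e^X-1}\big(\operatorname{tr}(A_{1,\mathrm{ave}})+2n\big)X\Big),$$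 where $A_{1,\mathrm{ave}}=\frac1X\int_0^XA_1(x)\,dx$. 2. For arbitrary $A_1\in L^2$, $\mathcal K_{\mathcal A^q}$ exists as a bounded operator and is unique, $\Psi_{\mathcal A^q}$ exists, $\mathcal K_{\mathcal A^q}$ is Hilbert–Schmidt, and $${\det}_2(I-\mathcal K_{\mathcal A^q})=\lim_{J\to\infty}F_J(\lambda)=\gamma\,(e^X-1)^{-2n}E_{\mathcal A^q},\qquad \gamma=\gamma_{\mathcal A^q}=\exp\Big(\frac{e^X}{e^X-1}\big(\operatorname{tr}(A_{1,\mathrm{ave}})+2n\big)X\Big).$$ Here $F_J(\lambda)=\det(I-\widehat{\mathcal K}_J)\,e^{\operatorname{tr}\widehat{\mathcal K}_J}$, where $\widehat{\mathcal K}_J$ is the truncation to $|j|,|k|\le J$ of the Fourier matrix of $(\partial_x-1)^{-1}(\mathcal A-1)$, with blocks $\big(\tfrac{2\pi ij}{X}-1\big)^{-1}\big(\widehat{\mathcal A}_{j-k}-\delta_{jk}I\big)$. Here $\widehat A_m=\frac1X\int_0^XA(x)e^{-2\pi imx/X}\,dx$ for a function $A$, the coefficients of the constant blocks $0,I$ of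 $\mathcal A$ are $0,\delta_{m0}I$, and those of the distribution $\partial_xA_1$ are $\tfrac{2\pi im}{X}\widehat A_{1,m}$. -/

import Mathlib

open MeasureTheory Filter Topology Set
open scoped Matrix ContDiff

noncomputable section

namespace PeriodicEvans

/-! ### Hilbert-Schmidt operators and the 2-modified Fredholm determinant -/

section Determinant

universe u

variable {H : Type u} [NormedAddCommGroup H] [InnerProductSpace ℂ H]

/-- `K` is Hilbert-Schmidt: `∑ ‖K e‖ ^ 2 < ∞` for every Hilbert basis `e` of `H`.
(A Hilbert basis indexed by a type in the universe of `H` always exists.) -/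
def IsHilbertSchmidt (K : H →L[ℂ] H) : Prop :=
  ∀ (ι : Type u) (e : HilbertBasis ι ℂ H), Summable fun i => ‖K (e i)‖ ^ 2

/-- The Galerkin approximation `P_V K |_V : V → V`, with `P_V` the orthogonal projection. -/
def galerkin (K : H →L[ℂ] H) (V : Submodule ℂ H) [FiniteDimensional ℂ V] : V →ₗ[ℂ] V :=
  (V.orthogonalProjectionOnto ∘L K ∘L V.subtypeL : V →L[ℂ] V)

/-- The 2-modified determinant `det₂(I - T) = det(I - T) e ^ (tr T)` in finite dimension. -/
def finiteDet₂ {V : Type*} [AddCommGroup V] [Module ℂ V] (T : V →ₗ[ℂ] V) : ℂ :=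
  LinearMap.det (1 - T) * Complex.exp (LinearMap.trace ℂ V T)

/-- `HasDet₂ K d` means `det₂(I - K) = d`: for every increasing sequence of finite-dimensional
subspaces with dense union, the 2-modified determinants of the Galerkin approximations of `K`
converge to `d`. -/
def HasDet₂ (K : H →L[ℂ] H) (d : ℂ) : Prop :=
  ∀ (V : ℕ → Submodule ℂ H) [∀ J, FiniteDimensional ℂ (V J)],
    Monotone V → Dense (⋃ J, (V J : Set H)) →
      Tendsto (fun J => finiteDet₂ (galerkin K (V J))) atTop (𝓝 d)

/-- On a separable space the value of `det₂` is unique. -/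
theorem HasDet₂.unique [TopologicalSpace.SeparableSpace H] {K : H →L[ℂ] H} {d d' : ℂ}
    (h : HasDet₂ K d) (h' : HasDet₂ K d') : d = d' := by
  let V : ℕ → Submodule ℂ H := fun J =>
    Submodule.span ℂ (TopologicalSpace.denseSeq H '' Set.Iio J)
  have : ∀ J, FiniteDimensional ℂ (V J) := fun J =>
    FiniteDimensional.span_of_finite ℂ ((Set.finite_Iio J).image _)
  have hmono : Monotone V := fun a b hab =>
    Submodule.span_mono (Set.image_mono (Set.Iio_subset_Iio hab))
  have hdense : Dense (⋃ J, (V J : Set H)) := by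
    refine (TopologicalSpace.denseRange_denseSeq H).mono ?_
    rintro _ ⟨k, rfl⟩
    exact Set.mem_iUnion.2 ⟨k + 1, Submodule.subset_span ⟨k, Nat.lt_succ_self k, rfl⟩⟩
  exact tendsto_nhds_unique (h V hmono hdense) (h' V hmono hdense)

end Determinant

/-! ### First-order systems with periodic coefficients -/

section System

variable {ι : Type*} [Fintype ι] [DecidableEq ι]

/-- The entries of the matrix function `M` are square integrable over one period. -/
def MemL2 (X : ℝ) {m : Type*} (M : ℝ → Matrix m m ℂ) : Prop :=
  ∀ i j, MemLp (fun x => M x i j) 2 (volume.restrict (Ioc 0 X))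

/-- The Hilbert space `L²([0,X]; ℂ^ι)`. -/
abbrev L2Space (X : ℝ) (ι : Type*) [Fintype ι] : Type _ :=
  Lp (EuclideanSpace ℂ ι) 2 (volume.restrict (Ioc 0 X))

/-- `Ψ` is the fundamental solution on `[0,X]` of `W' = M W` with `Ψ(0) = I`, in the sense of
Carathéodory, i.e. in integrated form. -/
def IsFundamentalSolution (X : ℝ) (M Ψ : ℝ → Matrix ι ι ℂ) : Prop :=
  ContinuousOn Ψ (Icc 0 X) ∧
    ∀ x ∈ Icc 0 X, ∀ i j, Ψ x i j = (1 : Matrix ι ι ℂ) i j + ∫ t in (0 : ℝ)..x, (M t * Ψ t) i j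

/-- `u = (∂ₓ - 1)⁻¹ g` with periodic boundary conditions: `u` is absolutely continuous on `[0,X]`,
`u(0) = u(X)` and `u' - u = g` almost everywhere, written in integrated form (`g` is an
integrable function in all uses). -/
def IsPeriodicSolution (X : ℝ) (g u : ℝ → EuclideanSpace ℂ ι) : Prop :=
  ContinuousOn u (Icc 0 X) ∧ u 0 = u X ∧
    ∀ x ∈ Icc 0 X, ∀ i, u x i = u 0 i + ∫ t in (0 : ℝ)..x, (u t i + g t i)

/-- `K` is the operator `(∂ₓ - 1)⁻¹ (M - 1)` on periodic `L²[0,X]`. -/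
def IsBirmanSchwinger (X : ℝ) (M : ℝ → Matrix ι ι ℂ) (K : L2Space X ι →L[ℂ] L2Space X ι) : Prop :=
  ∀ f : L2Space X ι, ∃ u : ℝ → EuclideanSpace ℂ ι,
    IsPeriodicSolution X (fun t => WithLp.toLp 2 ((M t - 1) *ᵥ (f t).ofLp)) u ∧
      K f =ᵐ[volume.restrict (Ioc 0 X)] u

/-- `γ = exp ( e^X / (1 - e^X) ∫₀^X (tr M(y) - d) dy )` for a system of size `d`. -/
def gammaFactor (X : ℝ) (M : ℝ → Matrix ι ι ℂ) : ℂ :=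
  Complex.exp (Complex.exp X / (1 - Complex.exp X) *
    ∫ y in (0 : ℝ)..X, ((M y).trace - (Fintype.card ι : ℂ)))

end System

/-! ### The second-order operator and its first-order systems -/

section Coefficients

variable {n : ℕ}

/-- `D` is the distributional derivative of `A` as an `X`-periodic matrix function. -/
def IsPeriodicWeakDeriv (X : ℝ) (A D : ℝ → Matrix (Fin n) (Fin n) ℂ) : Prop :=
  ∀ φ : ℝ → ℂ, ContDiff ℝ ∞ φ → Function.Periodic φ X → ∀ i j,
    ∫ x in (0 : ℝ)..X, deriv φ x * A x i j = -∫ x in (0 : ℝ)..X, φ x * D x i j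

/-- The coefficient matrix of the system for `W = (U, Uₓ)`; `D₁` stands for `∂ₓ A₁`. -/
def systemMatrix (A₀ A₁ D₁ B₀ : ℝ → Matrix (Fin n) (Fin n) ℂ) (lam : ℂ) (x : ℝ) :
    Matrix (Fin n ⊕ Fin n) (Fin n ⊕ Fin n) ℂ :=
  Matrix.fromBlocks 0 1 (lam • B₀ x - A₀ x - D₁ x) (-A₁ x)

/-- The coefficient matrix of the same equation for `W = (U, Uₓ + A₁ U)`, which involves no
derivative of `A₁`. -/
def quasiMatrix (A₀ A₁ B₀ : ℝ → Matrix (Fin n) (Fin n) ℂ) (lam : ℂ) (x : ℝ) :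
    Matrix (Fin n ⊕ Fin n) (Fin n ⊕ Fin n) ℂ :=
  Matrix.fromBlocks (-A₁ x) 1 (lam • B₀ x - A₀ x) 0

/-- The Fourier coefficient `(1/X) ∫₀^X A(x) e^{-2πimx/X} dx`, entry by entry. -/
def fourierMatrix (X : ℝ) (A : ℝ → Matrix (Fin n) (Fin n) ℂ) (m : ℤ) : Matrix (Fin n) (Fin n) ℂ :=
  Matrix.of fun i j => (X : ℂ)⁻¹ *
    ∫ x in (0 : ℝ)..X, A x i j * Complex.exp (-(2 * Real.pi * Complex.I * m * x / X))

/-- The mean over one period, entry by entry. -/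
def meanMatrix (X : ℝ) (A : ℝ → Matrix (Fin n) (Fin n) ℂ) : Matrix (Fin n) (Fin n) ℂ :=
  Matrix.of fun i j => (X : ℂ)⁻¹ * ∫ x in (0 : ℝ)..X, A x i j

/-- The `m`-th Fourier coefficient of the (possibly distributional) coefficient matrix for
`W = (U, Uₓ)`; that of `∂ₓ A₁` is `2πim/X` times that of `A₁`. -/
def systemFourier (X : ℝ) (A₀ A₁ B₀ : ℝ → Matrix (Fin n) (Fin n) ℂ) (lam : ℂ) (m : ℤ) :
    Matrix (Fin n ⊕ Fin n) (Fin n ⊕ Fin n) ℂ :=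
  Matrix.fromBlocks 0 (if m = 0 then 1 else 0)
    (lam • fourierMatrix X B₀ m - fourierMatrix X A₀ m
      - (2 * Real.pi * Complex.I * m / X : ℂ) • fourierMatrix X A₁ m)
    (-fourierMatrix X A₁ m)

/-- The truncation to wave numbers `|j|, |k| ≤ J` of the Fourier matrix of `(∂ₓ - 1)⁻¹ (𝒜 - 1)`,
with `𝒜` the coefficient matrix for `W = (U, Uₓ)`. -/
def truncatedBS (X : ℝ) (A₀ A₁ B₀ : ℝ → Matrix (Fin n) (Fin n) ℂ) (lam : ℂ) (J : ℕ) :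
    Matrix (Finset.Icc (-(J : ℤ)) J × (Fin n ⊕ Fin n)) (Finset.Icc (-(J : ℤ)) J × (Fin n ⊕ Fin n))
      ℂ :=
  Matrix.of fun p q => (2 * Real.pi * Complex.I * (p.1 : ℤ) / X - 1)⁻¹ *
    (systemFourier X A₀ A₁ B₀ lam ((p.1 : ℤ) - (q.1 : ℤ)) p.2 q.2 - if p = q then 1 else 0)

/-- The truncated determinant `F_J = det₂(I - 𝒦_J)`. -/
def truncatedF (X : ℝ) (A₀ A₁ B₀ : ℝ → Matrix (Fin n) (Fin n) ℂ) (lam : ℂ) (J : ℕ) : ℂ :=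
  (1 - truncatedBS X A₀ A₁ B₀ lam J).det * Complex.exp (truncatedBS X A₀ A₁ B₀ lam J).trace

end Coefficients

end PeriodicEvans

end

/-!
Write `K = (∂ₓ - 1)⁻¹ (M - 1)` with periodic boundary conditions. Variation of constants splits
`K = V + R`, where `V f (x) = ∫₀ˣ e ^ (x - y) (M y - 1) f(y) dy` is a Volterra operator and
`R f (x) = c e ^ x ∫₀^X e ^ (-y) (M y - 1) f(y) dy`, with `c = e ^ X / (1 - e ^ X)`, has finite rank.
Then formally

`det₂ (I - K) = det₂ (I - V) · det (I - (I - V)⁻¹ R) · e ^ (tr R)`.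

The first factor is `1`, as `V` is a Volterra operator. The exponent `tr R` is
`c ∫₀^X tr (M - 1)`, so the last factor is `γ_M`. Finally `(I - V)⁻¹` maps the columns of `e ^ x I` to
the columns of the fundamental solution `Ψ`, and the middle factor is the finite determinant
`det (I - c ∫₀^X e ^ (-y) (M y - 1) Ψ(y) dy) = det ((Ψ(X) - I) / (e ^ X - 1))`.

The determinants are limits of Galerkin determinants, and the factorization is carried out before the
limit: `exists_tendsto_finiteDet₂_galerkin_add` shows that a finite-rank perturbation multiplies them
by a convergent sequence. That `det₂ (I - V) = 1` (`IsVolterraKernel.tendsto_finiteDet₂_galerkin`) is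
obtained from the same lemma. Freezing the kernel of `V` on the cells of a partition gives a strictly
block triangular finite-rank operator, and the remainder `D` is small in the Hilbert-Schmidt norm. As
`(I - D)⁻¹` is causal, the perturbation determinant relative to `D` is exactly `1`
(`IsVolterraKernel.det_step`), while `det₂ (I - D)` is close to `1` by Schur triangularization
(`norm_finiteDet₂_sub_one_le`). The same decomposition shows that `I - V` is invertible, which yields
the fundamental solution.

For the truncated Fourier determinants `F_J`, the truncation of `∂ₓ A₁` is the commutator of the
truncated derivative with the truncated `A₁`. Hence the truncated systems for `(U, Uₓ)` and
`(U, Uₓ + A₁ U)` are conjugate under a unipotent matrix (`det_derivMatrix_sub_toeplitz`), and `F_J` is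
the Galerkin determinant of the operator for `(U, Uₓ + A₁ U)` on the trigonometric polynomials of
degree at most `J`.
-/

namespace PeriodicEvans

/-! ### Triangularization and the finite-dimensional 2-modified determinant -/

/-- Schur triangularization: every endomorphism of a finite-dimensional complex inner product
space is upper triangular in some orthonormal basis. -/
theorem exists_orthonormal_triangular (n : ℕ) :
    ∀ (V : Type*) [NormedAddCommGroup V] [InnerProductSpace ℂ V] [FiniteDimensional ℂ V]
      (T : V →ₗ[ℂ] V), Module.finrank ℂ V = n →
      ∃ b : OrthonormalBasis (Fin n) ℂ V, ∀ i j, i < j → inner ℂ (b j) (T (b i)) = 0 := by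
  induction n with
  | zero =>
    intro V _ _ _ T h
    exact ⟨(stdOrthonormalBasis ℂ V).reindex (finCongr h), fun i => i.elim0⟩
  | succ n ih =>
    intro V _ _ _ T h
    have : Nontrivial V := Module.nontrivial_of_finrank_pos (R := ℂ) (by omega)
    obtain ⟨μ, hμ⟩ := Module.End.exists_eigenvalue (LinearMap.adjoint T)
    obtain ⟨v₀, hv₀⟩ := hμ.exists_hasEigenvector
    have hv₀n : ‖v₀‖ ≠ 0 := norm_ne_zero_iff.2 hv₀.2
    set v : V := ((‖v₀‖ : ℂ)⁻¹) • v₀ with hv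
    have hvn : ‖v‖ = 1 := by
      rw [hv, norm_smul]; simp [hv₀n]
    have hTv : LinearMap.adjoint T v = μ • v := by
      rw [hv, map_smul, hv₀.apply_eq_smul, smul_comm]
    set W : Submodule ℂ V := (ℂ ∙ v)ᗮ with hW
    have hinv : ∀ w ∈ W, T w ∈ W := by
      intro w hw
      rw [hW, Submodule.mem_orthogonal_singleton_iff_inner_right] at hw ⊢
      rw [← LinearMap.adjoint_inner_left, hTv, inner_smul_left, hw, mul_zero]
    have hWr : Module.finrank ℂ W = n := by
      have h1 := Submodule.finrank_add_finrank_orthogonal (ℂ ∙ v)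
      rw [finrank_span_singleton (by rw [← norm_ne_zero_iff, hvn]; exact one_ne_zero), h] at h1
      rw [hW]
      omega
    obtain ⟨b', hb'⟩ := ih W (T.restrict hinv) hWr
    have hperp : ∀ w : W, inner ℂ v (w : V) = 0 := fun w =>
      Submodule.mem_orthogonal_singleton_iff_inner_right.1 w.2
    have hperp' : ∀ w : W, inner ℂ (w : V) v = 0 := fun w =>
      Submodule.mem_orthogonal_singleton_iff_inner_left.1 w.2
    have hin := orthonormal_iff_ite.1 b'.orthonormal
    let e : Fin (n + 1) → V := Fin.snoc (fun i => (b' i : V)) v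
    have hel : e (Fin.last n) = v := by simp [e]
    have hec : ∀ i : Fin n, e i.castSucc = b' i := by intro i; simp [e]
    have he : Orthonormal ℂ e := by
      rw [orthonormal_iff_ite]
      intro i j
      induction i using Fin.lastCases with
      | last =>
        induction j using Fin.lastCases with
        | last => rw [hel]; simp [inner_self_eq_norm_sq_to_K, hvn]
        | cast j => rw [hel, hec, hperp, if_neg (Fin.castSucc_lt_last j).ne']
      | cast i =>
        induction j using Fin.lastCases with
        | last => rw [hel, hec, hperp', if_neg (Fin.castSucc_lt_last i).ne]
        | cast j =>
          have := hin i j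
          rw [Submodule.coe_inner] at this
          rw [hec, hec, this]
          simp
    have hspan : ⊤ ≤ Submodule.span ℂ (Set.range e) := by
      rw [he.linearIndependent.span_eq_top_of_card_eq_finrank (by simp [h])]
    refine ⟨OrthonormalBasis.mk he hspan, fun i j hij => ?_⟩
    rw [OrthonormalBasis.coe_mk]
    induction j using Fin.lastCases with
    | last =>
      induction i using Fin.lastCases with
      | last => exact absurd hij (lt_irrefl _)
      | cast i => rw [hel, hec]; exact hperp ⟨T (b' i), hinv _ (b' i).2⟩
    | cast j =>
      induction i using Fin.lastCases with
      | last => exact absurd hij (not_lt.2 (Fin.le_last _))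
      | cast i =>
        rw [hec, hec]
        exact hb' i j (Fin.castSucc_lt_castSucc_iff.1 hij)

/-- If `∑ ‖T e‖ ^ 2 ≤ C ≤ 1` for all orthonormal bases, then `det₂(I - T)` is within
`e ^ (3C) - 1` of `1`: the eigenvalues satisfy `∑ |l| ^ 2 ≤ C` by triangularization, and
`(1 - l) e ^ l = 1 + O(|l| ^ 2)`. -/
theorem norm_finiteDet₂_sub_one_le {V : Type*} [NormedAddCommGroup V] [InnerProductSpace ℂ V]
    [FiniteDimensional ℂ V] (T : V →ₗ[ℂ] V) {C : ℝ} (hC : C ≤ 1)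
    (hT : ∀ b : OrthonormalBasis (Fin (Module.finrank ℂ V)) ℂ V, ∑ i, ‖T (b i)‖ ^ 2 ≤ C) :
    ‖finiteDet₂ T - 1‖ ≤ Real.exp (3 * C) - 1 := by
  obtain ⟨b, hb⟩ := exists_orthonormal_triangular _ V T rfl
  set l : Fin (Module.finrank ℂ V) → ℂ := fun i => inner ℂ (b i) (T (b i)) with hl
  have hli : ∀ i, ‖l i‖ ≤ ‖T (b i)‖ := fun i => by
    have := norm_inner_le_norm (𝕜 := ℂ) (b i) (T (b i))
    simpa [b.orthonormal.1 i] using this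
  have hlC : ∑ i, ‖l i‖ ^ 2 ≤ C :=
    (Finset.sum_le_sum fun i _ => pow_le_pow_left₀ (norm_nonneg _) (hli i) 2).trans (hT b)
  have hl1 : ∀ i, ‖l i‖ ≤ 1 := fun i => by
    have h1 : ‖l i‖ ^ 2 ≤ 1 := ((Finset.single_le_sum (f := fun i => ‖l i‖ ^ 2)
      (fun j _ => sq_nonneg _) (Finset.mem_univ i)).trans hlC).trans hC
    exact (sq_le_one_iff₀ (norm_nonneg _)).1 h1
  have hdet : LinearMap.det (1 - T) = ∏ i, (1 - l i) := by
    rw [← LinearMap.det_toMatrix b.toBasis, Matrix.det_of_isUpperTriangular]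
    · refine Finset.prod_congr rfl fun i _ => ?_
      simp [LinearMap.toMatrix_apply, b.repr_apply_apply, hl]
    · intro i j hij
      have hij' : j < i := hij
      simp [LinearMap.toMatrix_apply, b.repr_apply_apply, hb j i hij', hij'.ne']
  have htr : LinearMap.trace ℂ V T = ∑ i, l i := by
    rw [LinearMap.trace_eq_sum_inner T b]
  have hprod : finiteDet₂ T = ∏ i, (1 + ((1 - l i) * Complex.exp (l i) - 1)) := by
    rw [finiteDet₂, hdet, htr, Complex.exp_sum, ← Finset.prod_mul_distrib]
    exact Finset.prod_congr rfl fun i _ => by ring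
  have hterm : ∀ i, ‖(1 - l i) * Complex.exp (l i) - 1‖ ≤ 3 * ‖l i‖ ^ 2 := fun i => by
    have h2 := Complex.norm_exp_sub_one_sub_id_le (hl1 i)
    have h3 : (1 - l i) * Complex.exp (l i) - 1 =
        (1 - l i) * (Complex.exp (l i) - 1 - l i) - l i ^ 2 := by ring
    have h4 : ‖1 - l i‖ ≤ 2 := (norm_sub_le _ _).trans (by rw [norm_one]; linarith [hl1 i])
    rw [h3]
    refine (norm_sub_le _ _).trans ?_
    rw [norm_mul, norm_pow]
    nlinarith [mul_le_mul h4 h2 (norm_nonneg _) zero_le_two]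
  rw [hprod]
  refine (Finset.univ.norm_prod_one_add_sub_one_le _).trans ?_
  gcongr
  refine (Finset.sum_le_sum fun i _ => hterm i).trans ?_
  rw [← Finset.mul_sum]
  gcongr

/-! ### Galerkin approximations and finite-rank perturbations -/

section Galerkin

universe u

variable {H : Type u} [NormedAddCommGroup H] [InnerProductSpace ℂ H]

/-- `C` bounds the squared Hilbert-Schmidt norm of `K`, tested on finite orthonormal families. -/
def HilbertSchmidtBound (K : H →L[ℂ] H) (C : ℝ) : Prop :=
  ∀ (n : ℕ) (e : Fin n → H), Orthonormal ℂ e → ∑ i, ‖K (e i)‖ ^ 2 ≤ C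

theorem HilbertSchmidtBound.isHilbertSchmidt {K : H →L[ℂ] H} {C : ℝ}
    (h : HilbertSchmidtBound K C) : IsHilbertSchmidt K := by
  intro ι e
  refine summable_of_sum_le (c := C) (fun i => sq_nonneg _) fun s => ?_
  have := h s.card (fun i => e (s.equivFin.symm i))
    (e.orthonormal.comp _ (Subtype.val_injective.comp s.equivFin.symm.injective))
  rw [Equiv.sum_comp s.equivFin.symm (fun i : s => ‖K (e i)‖ ^ 2),
    Finset.sum_coe_sort s (fun i => ‖K (e i)‖ ^ 2)] at this
  exact this

theorem HilbertSchmidtBound.opNorm_le {K : H →L[ℂ] H} {C : ℝ}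
    (h : HilbertSchmidtBound K (C ^ 2)) (hC : 0 ≤ C) : ‖K‖ ≤ C := by
  refine K.opNorm_le_of_unit_norm hC fun x hx => ?_
  have := h 1 (fun _ => x) ⟨fun _ => hx, fun i j hij => absurd (Subsingleton.elim i j) hij⟩
  simp only [Finset.univ_unique, Finset.sum_const, Finset.card_singleton, one_smul] at this
  exact (sq_le_sq₀ (norm_nonneg _) hC).1 this

theorem HilbertSchmidtBound.norm_finiteDet₂_galerkin_sub_one_le {K : H →L[ℂ] H} {C : ℝ}
    (h : HilbertSchmidtBound K C) (hC : C ≤ 1) (V : Submodule ℂ H) [FiniteDimensional ℂ V] :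
    ‖finiteDet₂ (galerkin K V) - 1‖ ≤ Real.exp (3 * C) - 1 := by
  refine norm_finiteDet₂_sub_one_le _ hC fun b => ?_
  refine le_trans (Finset.sum_le_sum fun i _ => ?_)
    (h _ (fun i => (b i : H)) (b.orthonormal.comp_linearIsometry V.subtypeₗᵢ))
  exact pow_le_pow_left₀ (norm_nonneg _) (V.norm_orthogonalProjectionOnto_apply_le _) 2

variable {p : Type*} [Fintype p]

/-- The finite-rank operator `f ↦ ∑ ⟪k i, f⟫ φ i`. -/
noncomputable def finiteRankOp (k φ : p → H) : H →L[ℂ] H :=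
  ∑ i, InnerProductSpace.rankOne ℂ (φ i) (k i)

theorem finiteRankOp_apply (k φ : p → H) (f : H) :
    finiteRankOp k φ f = ∑ i, inner ℂ (k i) f • φ i := by
  simp [finiteRankOp]

/-- The Weinstein-Aronszajn identity for the 2-modified determinant. -/
theorem finiteDet₂_add_sum_smulRight [DecidableEq p] {V : Type*} [AddCommGroup V] [Module ℂ V]
    [FiniteDimensional ℂ V] (T : V →ₗ[ℂ] V) (k : p → V →ₗ[ℂ] ℂ) (φ c : p → V)
    (hc : ∀ q, c q - T (c q) = φ q) :
    finiteDet₂ (T + ∑ q, (k q).smulRight (φ q)) = finiteDet₂ T *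
      ((1 - Matrix.of fun i j => k i (c j)).det * Complex.exp (∑ i, k i (φ i))) := by
  have hfac : 1 - (T + ∑ q, (k q).smulRight (φ q)) =
      (1 - T) * (1 - ∑ q, (k q).smulRight (c q)) := by
    ext x
    simp only [LinearMap.sub_apply, Module.End.one_apply, LinearMap.add_apply, LinearMap.sum_apply,
      LinearMap.smulRight_apply, Module.End.mul_apply, map_sub, map_sum, map_smul]
    simp only [← hc, smul_sub, Finset.sum_sub_distrib]
    abel
  have hdet : LinearMap.det (1 - ∑ q, (k q).smulRight (c q)) =
      (1 - Matrix.of fun i j => k i (c j)).det := by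
    let b := Module.finBasis ℂ V
    have hAB : LinearMap.toMatrix b b (∑ q, (k q).smulRight (c q)) =
        (Matrix.of fun i q => b.repr (c q) i) * (Matrix.of fun q j => k q (b j)) := by
      ext i j
      simp [LinearMap.toMatrix_apply, Matrix.mul_apply, mul_comm]
    rw [← LinearMap.det_toMatrix b, map_sub, LinearMap.toMatrix_one, hAB,
      Matrix.det_one_sub_mul_comm]
    congr 2
    ext i j
    conv_rhs => rw [Matrix.of_apply, ← b.sum_repr (c j), map_sum]
    simp only [Matrix.mul_apply, Matrix.of_apply, map_smul, smul_eq_mul, mul_comm]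
  rw [finiteDet₂, finiteDet₂, hfac, map_mul, hdet, map_add, map_sum, Complex.exp_add]
  simp only [LinearMap.trace_smulRight]
  ring

theorem galerkin_add_finiteRankOp (A : H →L[ℂ] H) (k φ : p → H) (V : Submodule ℂ H)
    [FiniteDimensional ℂ V] :
    galerkin (A + finiteRankOp k φ) V = galerkin A V +
      ∑ q, ((innerₛₗ ℂ (k q)).comp V.subtype).smulRight (V.orthogonalProjectionOnto (φ q)) := by
  ext x
  simp [galerkin, finiteRankOp_apply]

theorem tendsto_starProjection {V : ℕ → Submodule ℂ H} [∀ J, FiniteDimensional ℂ (V J)]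
    (hmono : Monotone V) (hdense : Dense (⋃ J, (V J : Set H))) (x : H) :
    Tendsto (fun J => (V J).starProjection x) atTop (𝓝 x) := by
  refine Submodule.starProjection_tendsto_self V hmono x fun y _ => ?_
  have : (⋃ J, (V J : Set H)) ⊆ ((⨆ J, V J : Submodule ℂ H) : Set H) :=
    iUnion_subset fun J => SetLike.coe_subset_coe.2 (le_iSup V J)
  exact closure_mono this (hdense y)

theorem tendsto_starProjection_comp_finiteRankOp {V : ℕ → Submodule ℂ H}
    [∀ J, FiniteDimensional ℂ (V J)]
    (hV : ∀ x, Tendsto (fun J => (V J).starProjection x) atTop (𝓝 x)) (k φ : p → H) :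
    Tendsto (fun J => (V J).starProjection ∘L finiteRankOp k φ) atTop
      (𝓝 (finiteRankOp k φ)) := by
  have h : ∀ J, (V J).starProjection ∘L finiteRankOp k φ =
      finiteRankOp k (fun i => (V J).starProjection (φ i)) := fun J => by
    ext x
    simp [finiteRankOp_apply]
  simp only [h]
  unfold finiteRankOp
  refine tendsto_finsetSum _ fun i _ => ?_
  have hcont : Continuous fun x : H => InnerProductSpace.rankOne ℂ x (k i) := by fun_prop
  exact (hcont.tendsto _).comp (hV (φ i))

/-- Projections converging strongly to the identity converge in norm after composition with an
operator in the norm closure of the finite-rank operators. -/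
theorem tendsto_starProjection_comp {V : ℕ → Submodule ℂ H} [∀ J, FiniteDimensional ℂ (V J)]
    (hV : ∀ x, Tendsto (fun J => (V J).starProjection x) atTop (𝓝 x)) {A : H →L[ℂ] H}
    (hA : ∀ ε > 0, ∃ (q : Type) (_ : Fintype q) (k φ : q → H), ‖A - finiteRankOp k φ‖ ≤ ε) :
    Tendsto (fun J => (V J).starProjection ∘L A) atTop (𝓝 A) := by
  rw [Metric.tendsto_atTop]
  intro ε hε
  obtain ⟨q, _, k, φ, hB⟩ := hA (ε / 4) (by positivity)
  obtain ⟨N, hN⟩ := Metric.tendsto_atTop.1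
    (tendsto_starProjection_comp_finiteRankOp hV k φ) (ε / 4) (by positivity)
  refine ⟨N, fun J hJ => ?_⟩
  have h1 := hN J hJ
  rw [dist_eq_norm] at h1 ⊢
  set B := finiteRankOp k φ
  have h2 : (V J).starProjection ∘L A - A = (V J).starProjection ∘L (A - B) +
      ((V J).starProjection ∘L B - B) - (A - B) := by
    rw [ContinuousLinearMap.comp_sub]; abel
  have h3 : ‖(V J).starProjection ∘L (A - B)‖ ≤ ‖A - B‖ :=
    (ContinuousLinearMap.opNorm_comp_le _ _).trans
      (mul_le_of_le_one_left (norm_nonneg _) (V J).starProjection_norm_le)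
  rw [h2]
  calc _ ≤ ‖(V J).starProjection ∘L (A - B)‖ + ‖(V J).starProjection ∘L B - B‖ + ‖A - B‖ :=
        (norm_sub_le _ _).trans (by gcongr; exact norm_add_le _ _)
    _ < ε := by linarith

/-- Adding a finite-rank operator multiplies the 2-modified determinants of the Galerkin
approximations by a convergent sequence, whose limit is the perturbation determinant. The solutions
of `(1 - P A) c = P φ` lie in the range of `P`, so they solve the Galerkin equations. -/
theorem exists_tendsto_finiteDet₂_galerkin_add [CompleteSpace H] [DecidableEq p]
    {V : ℕ → Submodule ℂ H} [∀ J, FiniteDimensional ℂ (V J)]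
    (hV : ∀ x, Tendsto (fun J => (V J).starProjection x) atTop (𝓝 x)) {A : H →L[ℂ] H}
    (hA : Tendsto (fun J => (V J).starProjection ∘L A) atTop (𝓝 A)) (hunit : IsUnit (1 - A))
    (k φ ψ : p → H) (hψ : ∀ q, ψ q - A (ψ q) = φ q) :
    ∃ r : ℕ → ℂ, (∀ᶠ J in atTop, finiteDet₂ (galerkin (A + finiteRankOp k φ) (V J)) =
        finiteDet₂ (galerkin A (V J)) * r J) ∧
      Tendsto r atTop (𝓝 ((1 - Matrix.of fun i j => inner ℂ (k i) (ψ j)).det *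
        Complex.exp (∑ i, inner ℂ (k i) (φ i)))) := by
  let B : ℕ → H →L[ℂ] H := fun J => 1 - (V J).starProjection ∘L A
  have hB : Tendsto B atTop (𝓝 (1 - A)) := tendsto_const_nhds.sub hA
  let c : ℕ → p → H := fun J q => Ring.inverse (B J) ((V J).starProjection (φ q))
  have hc : ∀ q, Tendsto (fun J => c J q) atTop (𝓝 (ψ q)) := fun q => by
    have h1 : Tendsto (fun J => Ring.inverse (B J)) atTop (𝓝 (Ring.inverse (1 - A))) := by
      obtain ⟨w, hw⟩ := hunit
      rw [← hw] at hB ⊢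
      exact (NormedRing.inverse_continuousAt w).tendsto.comp hB
    have h2 : Ring.inverse (1 - A) (φ q) = ψ q := by
      have h3 : (1 - A) (ψ q) = φ q := by simp [hψ]
      rw [← h3, ← mul_apply_eq_comp, Ring.inverse_mul_cancel _ hunit]
      rfl
    rw [← h2]
    exact (isBoundedBilinearMap_apply.continuous.tendsto (Ring.inverse (1 - A), φ q)).comp
      (h1.prodMk_nhds (hV (φ q)))
  refine ⟨fun J => (1 - Matrix.of fun i j => inner ℂ (k i) (c J j)).det *
      Complex.exp (∑ i, inner ℂ (k i) ((V J).starProjection (φ i))), ?_, ?_⟩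
  · filter_upwards [hB.eventually (Units.isOpen.mem_nhds hunit)] with J hJ
    have hcJ : ∀ q, c J q = (V J).starProjection (A (c J q)) + (V J).starProjection (φ q) :=
      fun q => by
        have : B J (c J q) = (V J).starProjection (φ q) := by
          simp only [c]
          rw [← mul_apply_eq_comp, Ring.mul_inverse_cancel _ hJ]
          rfl
        rw [← this]
        simp [B]
    have hmem : ∀ q, c J q ∈ V J := fun q => by
      rw [hcJ q, Submodule.starProjection_apply, Submodule.starProjection_apply]
      exact (V J).add_mem (Subtype.coe_prop _) (Subtype.coe_prop _)
    rw [galerkin_add_finiteRankOp, finiteDet₂_add_sum_smulRight _ _ _ (fun q => ⟨c J q, hmem q⟩)]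
    · rfl
    · intro q
      apply Subtype.ext
      have h := hcJ q
      rw [Submodule.starProjection_apply, Submodule.starProjection_apply] at h
      rw [Submodule.coe_sub, sub_eq_iff_eq_add']
      exact h
  · refine Tendsto.mul ?_ ?_
    · refine ((continuous_id.matrix_det).tendsto _).comp ?_
      refine tendsto_const_nhds.sub (tendsto_pi_nhds.2 fun i => tendsto_pi_nhds.2 fun j => ?_)
      exact tendsto_const_nhds.inner (hc j)
    · refine (Complex.continuous_exp.tendsto _).comp (tendsto_finsetSum _ fun i _ => ?_)
      exact tendsto_const_nhds.inner (hV (φ i))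

theorem HilbertSchmidtBound.isUnit_one_sub [CompleteSpace H] {D : H →L[ℂ] H} {ε : ℝ}
    (h : HilbertSchmidtBound D (ε ^ 2)) (hε : 0 ≤ ε) (hε1 : ε < 1) : IsUnit (1 - D) :=
  isUnit_one_sub_of_norm_lt_one ((h.opNorm_le hε).trans_lt hε1)

/-- If `1 - D` is invertible and the perturbation determinant of a finite-rank operator relative to
`D` does not vanish, then `1 - D` stays invertible after adding that operator to `D`. -/
theorem isUnit_one_sub_add_finiteRankOp [CompleteSpace H] [DecidableEq p] {D : H →L[ℂ] H}
    (hD : IsUnit (1 - D)) (k φ ψ : p → H) (hψ : ∀ q, ψ q - D (ψ q) = φ q)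
    (hdet : (1 - Matrix.of fun i j => inner ℂ (k i) (ψ j)).det ≠ 0) :
    IsUnit (1 - (D + finiteRankOp k φ)) := by
  have hfac : 1 - (D + finiteRankOp k φ) = (1 - D) * (1 - finiteRankOp k ψ) := by
    ext x
    simp only [sub_apply, one_apply_eq_self,
      add_apply, mul_apply_eq_comp, map_sub, finiteRankOp_apply,
      map_sum, map_smul]
    simp only [← hψ, smul_sub, Finset.sum_sub_distrib]
    abel
  rw [hfac]
  refine hD.mul ?_
  set N : Matrix p p ℂ := 1 - Matrix.of fun i j => inner ℂ (k i) (ψ j) with hN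
  have hNu : IsUnit N.det := isUnit_iff_ne_zero.2 hdet
  have hNa : ∀ (a : p → ℂ) i, (N *ᵥ a) i = a i - inner ℂ (k i) (∑ j, a j • ψ j) := fun a i => by
    rw [hN, Matrix.sub_mulVec, Matrix.one_mulVec, Pi.sub_apply, inner_sum]
    congr 1
    refine Finset.sum_congr rfl fun j _ => ?_
    rw [inner_smul_right, mul_comm]
    rfl
  rw [ContinuousLinearMap.isUnit_iff_bijective]
  constructor
  · rw [injective_iff_map_eq_zero]
    intro x hx
    have hx' : x = ∑ j, inner ℂ (k j) x • ψ j := by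
      rw [← finiteRankOp_apply]
      exact sub_eq_zero.1 hx
    have h0 : N *ᵥ (fun j => inner ℂ (k j) x) = 0 := by
      ext i
      rw [hNa, ← hx', sub_self]
      rfl
    have h1 := congrArg (N⁻¹ *ᵥ ·) h0
    simp only [Matrix.mulVec_mulVec, Matrix.nonsing_inv_mul _ hNu, Matrix.one_mulVec,
      Matrix.mulVec_zero] at h1
    rw [hx']
    refine Finset.sum_eq_zero fun j _ => ?_
    rw [show inner ℂ (k j) x = 0 from congrFun h1 j, zero_smul]
  · intro y
    let a : p → ℂ := N⁻¹ *ᵥ fun i => inner ℂ (k i) y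
    have ha : N *ᵥ a = fun i => inner ℂ (k i) y := by
      simp only [a, Matrix.mulVec_mulVec, Matrix.mul_nonsing_inv _ hNu, Matrix.one_mulVec]
    refine ⟨y + ∑ j, a j • ψ j, ?_⟩
    have h1 : ∀ i, inner ℂ (k i) (y + ∑ j, a j • ψ j) = a i := fun i => by
      have := congrFun ha i
      rw [hNa] at this
      rw [inner_add_right, ← this]
      ring
    rw [sub_apply, finiteRankOp_apply]
    simp [h1]

end Galerkin

/-! ### Integrated scalar equations -/

theorem integral_mul_exp_mul (a : ℂ) (s x : ℝ) :
    ∫ t in s..x, a * Complex.exp (a * t) = Complex.exp (a * x) - Complex.exp (a * s) := by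
  have hd : ∀ t : ℝ, HasDerivAt (fun t : ℝ => Complex.exp (a * t)) (a * Complex.exp (a * t)) t :=
    fun t => by
      have h1 : HasDerivAt (fun t : ℝ => a * (t : ℂ)) a t := by
        simpa using (Complex.ofRealCLM.hasDerivAt (x := t)).const_mul a
      simpa [mul_comm] using h1.cexp
  have hc : Continuous fun t : ℝ => a * Complex.exp (a * t) := by fun_prop
  exact intervalIntegral.integral_eq_sub_of_hasDerivAt (fun t _ => hd t)
    (hc.intervalIntegrable s x)

/-- Integration by parts for an exponential against a primitive of an integrable function. -/
theorem integral_mul_exp_mul_primitive (a : ℂ) {x : ℝ} (hx : 0 ≤ x) {f : ℝ → ℂ}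
    (hf : IntervalIntegrable f volume 0 x) :
    ∫ t in (0 : ℝ)..x, a * Complex.exp (a * t) * ∫ s in (0 : ℝ)..t, f s =
      Complex.exp (a * x) * (∫ s in (0 : ℝ)..x, f s) -
        ∫ s in (0 : ℝ)..x, Complex.exp (a * s) * f s := by
  have hfi : IntegrableOn f (Ioc 0 x) := (intervalIntegrable_iff_integrableOn_Ioc_of_le hx).1 hf
  let w : ℝ → ℂ := fun t => a * Complex.exp (a * t)
  have hwc : Continuous w := by fun_prop
  have hw : IntegrableOn w (Ioc 0 x) := hwc.integrableOn_Ioc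
  let k : ℝ × ℝ → ℂ := {q : ℝ × ℝ | q.2 ≤ q.1}.indicator fun q => w q.1 * f q.2
  have hk : Integrable k ((volume.restrict (Ioc 0 x)).prod (volume.restrict (Ioc 0 x))) :=
    (hw.mul_prod hfi).indicator (measurableSet_le measurable_snd measurable_fst)
  have h1 : ∀ t ∈ Ioc 0 x, w t * ∫ s in (0 : ℝ)..t, f s = ∫ s in Ioc 0 x, k (t, s) := by
    intro t ht
    have : (fun s => k (t, s)) = (Iic t).indicator fun s => w t * f s := by
      ext s; by_cases h : s ≤ t <;> simp [k, h]
    rw [this, setIntegral_indicator measurableSet_Iic, integral_const_mul,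
      intervalIntegral.integral_of_le ht.1.le, Ioc_inter_Iic, min_eq_right ht.2]
  have h2 : ∀ s ∈ Ioc 0 x, ∫ t in Ioc 0 x, k (t, s) =
      (Complex.exp (a * x) - Complex.exp (a * s)) * f s := by
    intro s hs
    have : (fun t => k (t, s)) = (Ici s).indicator fun t => w t * f s := by
      ext t; by_cases h : s ≤ t <;> simp [k, h]
    have hset : Ioc 0 x ∩ Ici s = Icc s x := by
      ext t; simp only [mem_inter_iff, mem_Ioc, mem_Ici, mem_Icc]
      constructor
      · rintro ⟨⟨_, h⟩, h'⟩; exact ⟨h', h⟩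
      · rintro ⟨h, h'⟩; exact ⟨⟨hs.1.trans_le h, h'⟩, h⟩
    rw [this, setIntegral_indicator measurableSet_Ici, hset, integral_mul_const,
      integral_Icc_eq_integral_Ioc, ← intervalIntegral.integral_of_le hs.2,
      integral_mul_exp_mul]
  have hexp : IntervalIntegrable (fun s => Complex.exp (a * s) * f s) volume 0 x :=
    hf.continuousOn_mul (by fun_prop)
  calc _ = ∫ t in Ioc 0 x, ∫ s in Ioc 0 x, k (t, s) := by
        rw [intervalIntegral.integral_of_le hx]
        exact setIntegral_congr_fun measurableSet_Ioc h1
    _ = ∫ s in Ioc 0 x, ∫ t in Ioc 0 x, k (t, s) := integral_integral_swap hk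
    _ = ∫ s in (0 : ℝ)..x, (Complex.exp (a * x) * f s - Complex.exp (a * s) * f s) := by
        rw [intervalIntegral.integral_of_le hx]
        refine setIntegral_congr_fun measurableSet_Ioc fun s hs => ?_
        rw [← sub_mul]
        exact h2 s hs
    _ = _ := by
        rw [intervalIntegral.integral_sub (hf.const_mul _) hexp,
          intervalIntegral.integral_const_mul]

/-- Variation of constants for `u' = u + g` in integrated form. -/
theorem integrated_ode_iff {X : ℝ} (hX : 0 ≤ X) {g u : ℝ → ℂ} (u₀ : ℂ)
    (hg : IntervalIntegrable g volume 0 X) :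
    (ContinuousOn u (Icc 0 X) ∧
        ∀ x ∈ Icc 0 X, u x = u₀ + ∫ t in (0 : ℝ)..x, (u t + g t)) ↔
      ∀ x ∈ Icc 0 X, u x = Complex.exp x *
        (u₀ + ∫ t in (0 : ℝ)..x, Complex.exp (-t) * g t) := by
  have hsub : ∀ x ∈ Icc 0 X, uIcc 0 x ⊆ uIcc 0 X := fun x hx => by
    rw [uIcc_of_le hx.1, uIcc_of_le hX]; exact Icc_subset_Icc_right hx.2
  have hgE : IntervalIntegrable (fun t : ℝ => Complex.exp (-t) * g t) volume 0 X :=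
    hg.continuousOn_mul (by fun_prop)
  constructor
  · rintro ⟨hc, hu⟩ x hx
    have hui : IntervalIntegrable u volume 0 x :=
      (hc.mono (by rw [uIcc_of_le hx.1]; exact Icc_subset_Icc_right hx.2)).intervalIntegrable
    have hgi := hg.mono_set (hsub x hx)
    have hexp : Continuous fun t : ℝ => Complex.exp (-1 * (t : ℂ)) := by fun_prop
    have hEu : IntervalIntegrable (fun t : ℝ => Complex.exp (-1 * t) * u t) volume 0 x :=
      hui.continuousOn_mul hexp.continuousOn
    have hEg : IntervalIntegrable (fun t : ℝ => Complex.exp (-1 * t) * g t) volume 0 x :=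
      hgi.continuousOn_mul hexp.continuousOn
    have key := integral_mul_exp_mul_primitive (-1) hx.1 (hui.add hgi)
    have hleft : ∫ t in (0 : ℝ)..x, -1 * Complex.exp (-1 * t) * ∫ s in (0 : ℝ)..t, (u s + g s) =
        -(∫ t in (0 : ℝ)..x, Complex.exp (-1 * t) * u t) -
          u₀ * (Complex.exp (-1 * x) - 1) := by
      have h0 := integral_mul_exp_mul (-1) 0 x
      simp only [Complex.ofReal_zero, mul_zero, Complex.exp_zero] at h0
      have hcE : Continuous fun t : ℝ => u₀ * (-1 * Complex.exp (-1 * (t : ℂ))) := by fun_prop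
      rw [← h0, ← intervalIntegral.integral_neg, ← intervalIntegral.integral_const_mul]
      have hneg : IntervalIntegrable (fun t : ℝ => -(Complex.exp (-1 * t) * u t)) volume 0 x :=
        hEu.neg
      rw [← intervalIntegral.integral_sub hneg (hcE.intervalIntegrable 0 x)]
      refine intervalIntegral.integral_congr fun t ht => ?_
      rw [uIcc_of_le hx.1] at ht
      have := hu t ⟨ht.1, ht.2.trans hx.2⟩
      rw [show ∫ s in (0 : ℝ)..t, (u s + g s) = u t - u₀ by rw [this]; ring]
      ring
    have hright : ∫ s in (0 : ℝ)..x, Complex.exp (-1 * s) * (u s + g s) =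
        (∫ s in (0 : ℝ)..x, Complex.exp (-1 * s) * u s) +
          ∫ s in (0 : ℝ)..x, Complex.exp (-1 * s) * g s := by
      rw [← intervalIntegral.integral_add hEu hEg]
      exact intervalIntegral.integral_congr fun t _ => mul_add _ _ _
    have hxu := hu x hx
    rw [hleft, hright, show ∫ s in (0 : ℝ)..x, (u s + g s) = u x - u₀ by rw [hxu]; ring] at key
    simp only [neg_one_mul] at key
    have hE : Complex.exp (x : ℂ) * Complex.exp (-x) = 1 := by
      rw [← Complex.exp_add]; simp
    linear_combination (-Complex.exp x) * key - (u x) * hE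
  · intro hu
    have hprim : ContinuousOn (fun x => ∫ t in (0 : ℝ)..x, Complex.exp (-t) * g t) (Icc 0 X) := by
      have := intervalIntegral.continuousOn_primitive_interval
        (μ := volume) (f := fun t : ℝ => Complex.exp (-t) * g t) (a := 0) (b := X)
        ((intervalIntegrable_iff' enorm_ne_top).1 hgE)
      rwa [uIcc_of_le hX] at this
    have hcont : ContinuousOn u (Icc 0 X) := by
      refine ContinuousOn.congr ?_ hu
      exact (by fun_prop : Continuous fun x : ℝ => Complex.exp x).continuousOn.mul
        (continuousOn_const.add hprim)
    refine ⟨hcont, fun x hx => ?_⟩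
    have hsx : uIcc 0 x ⊆ Icc 0 X := by rw [uIcc_of_le hx.1]; exact Icc_subset_Icc_right hx.2
    have hui : IntervalIntegrable u volume 0 x := (hcont.mono hsx).intervalIntegrable
    have hgi := hg.mono_set (hsub x hx)
    have key := integral_mul_exp_mul_primitive 1 hx.1 (hgE.mono_set (hsub x hx))
    have h0 := integral_mul_exp_mul 1 0 x
    simp only [one_mul, Complex.ofReal_zero, Complex.exp_zero] at h0 key
    have h1 : ∀ s : ℝ, Complex.exp s * (Complex.exp (-s) * g s) = g s := fun s => by
      rw [← mul_assoc, ← Complex.exp_add]; simp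
    simp only [h1] at key
    have hU : ∫ t in (0 : ℝ)..x, u t = u₀ * (Complex.exp x - 1) +
        ∫ t in (0 : ℝ)..x, Complex.exp t * ∫ s in (0 : ℝ)..t, Complex.exp (-s) * g s := by
      rw [← h0, ← intervalIntegral.integral_const_mul, ← intervalIntegral.integral_add]
      · refine intervalIntegral.integral_congr fun t ht => ?_
        rw [hu t (hsx ht)]
        ring
      · exact Continuous.intervalIntegrable (by fun_prop) _ _
      · refine ContinuousOn.intervalIntegrable ?_
        exact (by fun_prop : Continuous fun x : ℝ => Complex.exp x).continuousOn.mul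
          (hprim.mono hsx)
    rw [intervalIntegral.integral_add hui hgi, hU, key, hu x hx]
    ring

/-! ### Operators on `L²([0,X]; ℂ^ι)` given by kernels -/

section Kernel

variable {X : ℝ} {ι : Type} [Fintype ι]

theorem norm_sq_eq_integral (f : L2Space X ι) :
    ‖f‖ ^ 2 = ∫ x in Ioc 0 X, ‖f x‖ ^ 2 := by
  have h := L2.inner_def (𝕜 := ℂ) f f
  have h2 : ∀ x, inner ℂ (f x) (f x) = ((‖f x‖ ^ 2 : ℝ) : ℂ) := fun x => by
    rw [inner_self_eq_norm_sq_to_K]; norm_cast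
  simp only [h2] at h
  rw [inner_self_eq_norm_sq_to_K, integral_complex_ofReal] at h
  apply Complex.ofReal_injective
  push_cast
  exact h

theorem exists_indicator_multiplication (X : ℝ) (ι : Type) [Fintype ι] (t : ℝ) :
    ∃ T : L2Space X ι →L[ℂ] L2Space X ι, ∀ f : L2Space X ι,
      T f =ᵐ[volume.restrict (Ioc 0 X)] (Ioc 0 t).indicator f := by
  have hmem : ∀ f : L2Space X ι, MemLp ((Ioc 0 t).indicator f) 2 (volume.restrict (Ioc 0 X)) :=
    fun f => (Lp.memLp f).indicator measurableSet_Ioc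
  let T : L2Space X ι →ₗ[ℂ] L2Space X ι :=
    { toFun := fun f => (hmem f).toLp _
      map_add' := fun f g => by
        rw [← MemLp.toLp_add, MemLp.toLp_eq_toLp_iff, ← indicator_add']
        filter_upwards [Lp.coeFn_add f g] with x hx
        by_cases h : x ∈ Ioc 0 t
        · rw [indicator_of_mem h, indicator_of_mem h, hx, Pi.add_apply]
        · rw [indicator_of_notMem h, indicator_of_notMem h]
      map_smul' := fun c f => by
        rw [RingHom.id_apply, ← MemLp.toLp_const_smul, MemLp.toLp_eq_toLp_iff]
        filter_upwards [Lp.coeFn_smul c f] with x hx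
        by_cases h : x ∈ Ioc 0 t
        · rw [indicator_of_mem h, Pi.smul_apply, indicator_of_mem h, hx, Pi.smul_apply]
        · rw [indicator_of_notMem h, Pi.smul_apply, indicator_of_notMem h, smul_zero] }
  refine ⟨T.mkContinuous 1 fun f => ?_, fun f => MemLp.coeFn_toLp (hmem f)⟩
  rw [one_mul]
  refine Lp.norm_le_norm_of_ae_le ?_
  filter_upwards [MemLp.coeFn_toLp (hmem f)] with x hx
  change ‖(hmem f).toLp _ x‖ ≤ _
  rw [hx]
  exact norm_indicator_le_norm_self _ _

/-- Multiplication by the indicator function of `(0, t]`. -/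
noncomputable def cutoff (X : ℝ) (ι : Type) [Fintype ι] (t : ℝ) :
    L2Space X ι →L[ℂ] L2Space X ι :=
  (exists_indicator_multiplication X ι t).choose

theorem coeFn_cutoff (t : ℝ) (f : L2Space X ι) :
    cutoff X ι t f =ᵐ[volume.restrict (Ioc 0 X)] (Ioc 0 t).indicator f :=
  (exists_indicator_multiplication X ι t).choose_spec f

theorem norm_cutoff_apply_le (t : ℝ) (f : L2Space X ι) : ‖cutoff X ι t f‖ ≤ ‖f‖ := by
  refine Lp.norm_le_norm_of_ae_le ?_
  filter_upwards [coeFn_cutoff t f] with x hx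
  rw [hx]
  exact norm_indicator_le_norm_self _ _

theorem cutoff_cutoff (s t : ℝ) (f : L2Space X ι) :
    cutoff X ι s (cutoff X ι t f) = cutoff X ι (min s t) f := by
  apply Lp.ext
  filter_upwards [coeFn_cutoff s (cutoff X ι t f), coeFn_cutoff t f, coeFn_cutoff (min s t) f]
    with x h1 h2 h3
  rw [h1, h3]
  by_cases hs : x ∈ Ioc 0 s
  · rw [indicator_of_mem hs, h2]
    by_cases ht : x ∈ Ioc 0 t
    · rw [indicator_of_mem ht,
        indicator_of_mem (show x ∈ Ioc 0 (min s t) from ⟨hs.1, le_min hs.2 ht.2⟩)]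
    · rw [indicator_of_notMem ht,
        indicator_of_notMem fun h : x ∈ Ioc 0 (min s t) => ht ⟨h.1, h.2.trans (min_le_right _ _)⟩]
  · rw [indicator_of_notMem hs,
      indicator_of_notMem fun h : x ∈ Ioc 0 (min s t) => hs ⟨h.1, h.2.trans (min_le_left _ _)⟩]

theorem inner_cutoff {t : ℝ} (ht : t ∈ Icc 0 X) (h f : L2Space X ι) :
    inner ℂ (cutoff X ι t h) f = ∫ y in (0 : ℝ)..t, inner ℂ (h y) (f y) := by
  rw [L2.inner_def, intervalIntegral.integral_of_le ht.1]
  have h1 : ∫ y in Ioc 0 X, inner ℂ (cutoff X ι t h y) (f y) =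
      ∫ y in Ioc 0 X, (Ioc 0 t).indicator (fun y => inner ℂ (h y) (f y)) y := by
    refine integral_congr_ae ?_
    filter_upwards [coeFn_cutoff t h] with y hy
    rw [hy]
    by_cases hyt : y ∈ Ioc 0 t <;> simp [hyt]
  rw [h1, setIntegral_indicator measurableSet_Ioc,
    inter_eq_right.2 (Ioc_subset_Ioc_right ht.2)]

theorem inner_cutoff_left (t : ℝ) (h f : L2Space X ι) :
    inner ℂ (cutoff X ι t h) f = inner ℂ h (cutoff X ι t f) := by
  rw [L2.inner_def, L2.inner_def]
  refine integral_congr_ae ?_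
  filter_upwards [coeFn_cutoff t h, coeFn_cutoff t f] with y h1 h2
  rw [h1, h2]
  by_cases hyt : y ∈ Ioc 0 t <;> simp [hyt]

theorem cutoff_self (f : L2Space X ι) : cutoff X ι X f = f := by
  apply Lp.ext
  filter_upwards [coeFn_cutoff X f, ae_restrict_mem measurableSet_Ioc] with x h1 h2
  rw [h1, indicator_of_mem h2]

theorem continuousOn_inner_cutoff (h f : L2Space X ι) :
    ContinuousOn (fun t => inner ℂ (cutoff X ι t h) f) (Icc 0 X) := by
  have h1 : IntegrableOn (fun y => inner ℂ (h y) (f y)) (Icc 0 X) := by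
    rw [integrableOn_Icc_iff_integrableOn_Ioc]
    exact L2.integrable_inner h f
  exact (intervalIntegral.continuousOn_primitive h1).congr fun t ht => by
    rw [inner_cutoff ht, intervalIntegral.integral_of_le ht.1]

/-- `‖1_{(0,t]} h - 1_{(0,s]} h‖ ^ 2` is the increment of the continuous function
`t ↦ ⟪1_{(0,t]} h, h⟫`. -/
theorem continuousOn_cutoff (h : L2Space X ι) :
    ContinuousOn (fun t => cutoff X ι t h) (Icc 0 X) := by
  have key : ∀ s t, s ≤ t → ‖cutoff X ι t h - cutoff X ι s h‖ ^ 2 =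
      ‖inner ℂ (cutoff X ι t h) h - inner ℂ (cutoff X ι s h) h‖ := by
    intro s t hst
    have h1 : inner ℂ (cutoff X ι t h - cutoff X ι s h) (cutoff X ι t h - cutoff X ι s h) =
        inner ℂ (cutoff X ι t h) h - inner ℂ (cutoff X ι s h) h := by
      rw [inner_sub_right, ← inner_cutoff_left, ← inner_cutoff_left, map_sub, map_sub,
        cutoff_cutoff, cutoff_cutoff, cutoff_cutoff, cutoff_cutoff, min_self, min_self,
        min_eq_left hst, min_eq_right hst, sub_self, inner_zero_left, sub_zero, inner_sub_left]
    rw [← h1, inner_self_eq_norm_sq_to_K]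
    simp
  have key' : ∀ s t, ‖cutoff X ι t h - cutoff X ι s h‖ ^ 2 =
      ‖inner ℂ (cutoff X ι t h) h - inner ℂ (cutoff X ι s h) h‖ := by
    intro s t
    rcases le_total s t with hst | hst
    · exact key s t hst
    · rw [norm_sub_rev, key t s hst, norm_sub_rev]
  intro s hs
  have h1 := (continuousOn_inner_cutoff h h) s hs
  rw [ContinuousWithinAt, tendsto_iff_norm_sub_tendsto_zero] at h1 ⊢
  have h2 := (Real.continuous_sqrt.tendsto 0).comp h1
  rw [Real.sqrt_zero] at h2
  refine h2.congr fun t => ?_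
  simp only [Function.comp_apply]
  rw [← key', Real.sqrt_sq (norm_nonneg _)]

/-- `A` is the operator `(A f)(x) = (⟪κ a x, f⟫)ₐ`, with an `L²`-valued kernel `κ`. -/
def HasKernel (A : L2Space X ι →L[ℂ] L2Space X ι) (κ : ι → ℝ → L2Space X ι) : Prop :=
  ∀ f, A f =ᵐ[volume.restrict (Ioc 0 X)] fun x => WithLp.toLp 2 fun a => inner ℂ (κ a x) f

theorem exists_hasKernel (hX : 0 ≤ X) (κ : ι → ℝ → L2Space X ι)
    (hκ : ∀ a, ContinuousOn (κ a) (Icc 0 X)) : ∃ A, HasKernel A κ := by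
  have hb : ∀ a, ∃ C, ∀ x ∈ Icc 0 X, ‖κ a x‖ ≤ C := fun a =>
    isCompact_Icc.exists_bound_of_continuousOn (hκ a)
  choose C hC using hb
  have hmem : ∀ f : L2Space X ι, MemLp (fun x => WithLp.toLp 2 fun a => inner ℂ (κ a x) f :
      ℝ → EuclideanSpace ℂ ι) 2 (volume.restrict (Ioc 0 X)) := fun f => by
    refine MemLp.of_eval_piLp fun a => MemLp.of_bound (C := C a * ‖f‖) ?_ ?_
    · refine ContinuousOn.aestronglyMeasurable ?_ measurableSet_Ioc
      exact ((hκ a).inner continuousOn_const).mono Ioc_subset_Icc_self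
    · filter_upwards [ae_restrict_mem measurableSet_Ioc] with x hx
      exact (norm_inner_le_norm _ _).trans
        (mul_le_mul_of_nonneg_right (hC a x (Ioc_subset_Icc_self hx)) (norm_nonneg _))
  let T : L2Space X ι →ₗ[ℂ] L2Space X ι :=
    { toFun := fun f => (hmem f).toLp _
      map_add' := fun f g => by
        rw [← MemLp.toLp_add]
        congr 1
        ext x a
        simp [inner_add_right]
      map_smul' := fun c f => by
        rw [RingHom.id_apply, ← MemLp.toLp_const_smul]
        congr 1
        ext x a
        simp [inner_smul_right] }
  refine ⟨T.mkContinuous ((volume.restrict (Ioc 0 X)).real univ ^ (2 : ENNReal).toReal⁻¹ *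
    ∑ a, C a) fun f => ?_, fun f => MemLp.coeFn_toLp (hmem f)⟩
  rw [mul_assoc]
  have hsum : 0 ≤ (∑ a, C a) * ‖f‖ := mul_nonneg (Finset.sum_nonneg fun a _ =>
    (norm_nonneg _).trans (hC a 0 ⟨le_rfl, hX⟩)) (norm_nonneg _)
  refine Lp.norm_le_of_ae_bound hsum ?_
  filter_upwards [MemLp.coeFn_toLp (hmem f), ae_restrict_mem measurableSet_Ioc] with x hx hxX
  change ‖(hmem f).toLp _ x‖ ≤ _
  rw [hx, EuclideanSpace.norm_eq]
  refine (Real.sqrt_le_sqrt (Finset.sum_sq_le_sq_sum_of_nonneg fun a _ => norm_nonneg _)).trans ?_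
  rw [Real.sqrt_sq (Finset.sum_nonneg fun a _ => norm_nonneg _), Finset.sum_mul]
  exact Finset.sum_le_sum fun a _ => (norm_inner_le_norm _ _).trans
    (mul_le_mul_of_nonneg_right (hC a x (Ioc_subset_Icc_self hxX)) (norm_nonneg _))

/-- Bessel's inequality, integrated over `x`. -/
theorem HasKernel.hilbertSchmidtBound (hX : 0 ≤ X) {A : L2Space X ι →L[ℂ] L2Space X ι}
    {κ : ι → ℝ → L2Space X ι} (hA : HasKernel A κ) {C : ℝ}
    (hC : ∀ a, ∀ x ∈ Ioc 0 X, ‖κ a x‖ ≤ C) :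
    HilbertSchmidtBound A (X * (Fintype.card ι * C ^ 2)) := by
  intro n e he
  have hint : ∀ i, Integrable (fun x => ‖A (e i) x‖ ^ 2) (volume.restrict (Ioc 0 X)) := fun i =>
    (Lp.memLp (A (e i))).integrable_norm_pow two_ne_zero
  have hall : ∀ᵐ x ∂volume.restrict (Ioc 0 X), ∀ i, A (e i) x =
      WithLp.toLp 2 fun a => inner ℂ (κ a x) (e i) := ae_all_iff.2 fun i => hA (e i)
  calc ∑ i, ‖A (e i)‖ ^ 2 = ∫ x in Ioc 0 X, ∑ i, ‖A (e i) x‖ ^ 2 := by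
        rw [integral_finsetSum _ fun i _ => hint i]
        exact Finset.sum_congr rfl fun i _ => norm_sq_eq_integral _
    _ ≤ ∫ _ in Ioc 0 X, Fintype.card ι * C ^ 2 := by
        refine integral_mono_ae (integrable_finsetSum _ fun i _ => hint i)
          (integrable_const _) ?_
        filter_upwards [hall, ae_restrict_mem measurableSet_Ioc] with x hx hxX
        have h1 : ∀ i, ‖A (e i) x‖ ^ 2 = ∑ a, ‖inner ℂ (e i) (κ a x)‖ ^ 2 := fun i => by
          rw [hx i, EuclideanSpace.norm_sq_eq]
          exact Finset.sum_congr rfl fun a _ => by rw [norm_inner_symm]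
        simp only [h1]
        rw [Finset.sum_comm]
        calc _ ≤ ∑ _a : ι, C ^ 2 := Finset.sum_le_sum fun a _ =>
              (he.sum_inner_products_le (κ a x)).trans
                (pow_le_pow_left₀ (norm_nonneg _) (hC a x hxX) 2)
          _ = _ := by simp
    _ = _ := by simp [hX]

theorem memLp_of_continuousOn {u : ℝ → EuclideanSpace ℂ ι} (hu : ContinuousOn u (Icc 0 X)) :
    MemLp u 2 (volume.restrict (Ioc 0 X)) := by
  obtain ⟨C, hC⟩ := isCompact_Icc.exists_bound_of_continuousOn hu
  refine MemLp.of_bound (C := C)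
    ((hu.mono Ioc_subset_Icc_self).aestronglyMeasurable measurableSet_Ioc) ?_
  filter_upwards [ae_restrict_mem measurableSet_Ioc] with x hx
  exact hC x (Ioc_subset_Icc_self hx)

theorem HasKernel.unique {A B : L2Space X ι →L[ℂ] L2Space X ι} {κ : ι → ℝ → L2Space X ι}
    (hA : HasKernel A κ) (hB : HasKernel B κ) : A = B := by
  ext1 f
  exact Lp.ext ((hA f).trans (hB f).symm)

theorem HasKernel.isHilbertSchmidt (hX : 0 ≤ X) {A : L2Space X ι →L[ℂ] L2Space X ι}
    {κ : ι → ℝ → L2Space X ι} (hA : HasKernel A κ) (hκ : ∀ a, ContinuousOn (κ a) (Icc 0 X)) :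
    IsHilbertSchmidt A := by
  choose C hC using fun a => isCompact_Icc.exists_bound_of_continuousOn (hκ a)
  refine (hA.hilbertSchmidtBound hX (C := ∑ a, |C a|) fun a x hx => ?_).isHilbertSchmidt
  exact (hC a x (Ioc_subset_Icc_self hx)).trans ((le_abs_self _).trans
    (Finset.single_le_sum (f := fun a => |C a|) (fun a _ => abs_nonneg _) (Finset.mem_univ a)))

end Kernel

/-! ### Volterra operators -/

section Volterra

variable {X : ℝ} {ι : Type} [Fintype ι]

/-- The points dividing `[0, X]` into `m` equal cells. -/
noncomputable def node (X : ℝ) (m p : ℕ) : ℝ := X * p / m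

theorem node_mono (hX : 0 ≤ X) (m : ℕ) : Monotone (node X m) := fun p q h => by
  unfold node
  have : (p : ℝ) ≤ q := by exact_mod_cast h
  gcongr

theorem node_mem (hX : 0 ≤ X) {m p : ℕ} (hp : p ≤ m) : node X m p ∈ Icc 0 X := by
  unfold node
  refine ⟨by positivity, ?_⟩
  rcases Nat.eq_zero_or_pos m with rfl | hm
  · simpa using hX
  · have h1 : (p : ℝ) ≤ m := by exact_mod_cast hp
    have h2 : (0 : ℝ) < m := by exact_mod_cast hm
    rw [div_le_iff₀ h2]
    exact mul_le_mul_of_nonneg_left h1 hX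

theorem exists_cell (hX : 0 < X) {m : ℕ} (hm : 0 < m) {x : ℝ} (hx : x ∈ Ioc 0 X) :
    ∃ p : Fin m, ∀ p' : Fin m, x ∈ Ioc (node X m p') (node X m (p' + 1)) ↔ p' = p := by
  have hm' : (0 : ℝ) < m := by exact_mod_cast hm
  have hex : ∃ q : ℕ, x ≤ node X m q := ⟨m, by
    rw [node, mul_div_cancel_right₀ _ hm'.ne']; exact hx.2⟩
  classical
  set q := Nat.find hex with hq
  have hqx : x ≤ node X m q := Nat.find_spec hex
  have hq0 : q ≠ 0 := fun h => by
    rw [h, node] at hqx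
    simp only [Nat.cast_zero, mul_zero, zero_div] at hqx
    exact absurd hx.1 (not_lt.2 hqx)
  have hqm : q ≤ m := Nat.find_min' hex (by
    rw [node, mul_div_cancel_right₀ _ hm'.ne']; exact hx.2)
  have hlt : ∀ r, r < q → node X m r < x := fun r hr => not_le.1 (Nat.find_min hex hr)
  refine ⟨⟨q - 1, by omega⟩, fun p' => ⟨fun h => ?_, fun h => ?_⟩⟩
  · apply Fin.ext
    have h1 : q ≤ (p' : ℕ) + 1 := Nat.find_min' hex h.2
    have h2 : (p' : ℕ) < q := by
      by_contra hc
      exact absurd (h.1.trans_le hqx) (not_lt.2 (node_mono hX.le m (not_lt.1 hc)))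
    simp only
    omega
  · subst h
    refine ⟨hlt _ (by simp only; omega), ?_⟩
    simp only
    rwa [Nat.sub_add_cancel (Nat.one_le_iff_ne_zero.2 hq0)]

/-- The coordinate function `1_{(x_p, x_{p+1}]} δ_a` of a cell. -/
noncomputable def cellFun [DecidableEq ι] (X : ℝ) (m : ℕ) (q : Fin m × ι) : L2Space X ι :=
  indicatorConstLp 2 (measurableSet_Ioc (a := node X m q.1) (b := node X m (q.1 + 1)))
    (measure_ne_top (volume.restrict (Ioc 0 X)) _) (EuclideanSpace.single q.2 1)

theorem coeFn_cellFun [DecidableEq ι] (m : ℕ) (q : Fin m × ι) :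
    cellFun X m q =ᵐ[volume.restrict (Ioc 0 X)]
      (Ioc (node X m q.1) (node X m (q.1 + 1))).indicator
        fun _ => EuclideanSpace.single q.2 (1 : ℂ) :=
  indicatorConstLp_coeFn

/-- The kernel frozen at the left end point of each cell. -/
noncomputable def stepKernel (κ : ι → ℝ → L2Space X ι) (m : ℕ) (q : Fin m × ι) : L2Space X ι :=
  κ q.2 (node X m q.1)

/-- The error of the step approximation of a kernel. -/
noncomputable def stepError (κ : ι → ℝ → L2Space X ι) (m : ℕ) (a : ι) (x : ℝ) : L2Space X ι :=
  κ a x - ∑ p : Fin m, (Ioc (node X m p) (node X m (p + 1))).indicator (fun _ => κ a (node X m p)) x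

theorem HasKernel.sub_finiteRankOp [DecidableEq ι] {A : L2Space X ι →L[ℂ] L2Space X ι}
    {κ : ι → ℝ → L2Space X ι} (hA : HasKernel A κ) (m : ℕ) :
    HasKernel (A - finiteRankOp (stepKernel κ m) (cellFun X m)) (stepError κ m) := by
  intro f
  rw [sub_apply, finiteRankOp_apply]
  have h1 : ∀ᵐ x ∂volume.restrict (Ioc 0 X), ∀ q : Fin m × ι,
      (inner ℂ (stepKernel κ m q) f • cellFun X m q : L2Space X ι) x =
        inner ℂ (stepKernel κ m q) f • (Ioc (node X m q.1) (node X m (q.1 + 1))).indicator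
          (fun _ => EuclideanSpace.single q.2 (1 : ℂ)) x := by
    refine ae_all_iff.2 fun q => ?_
    filter_upwards [Lp.coeFn_smul (inner ℂ (stepKernel κ m q) f) (cellFun X m q),
      coeFn_cellFun m q] with x h2 h3
    rw [h2, Pi.smul_apply, h3]
  filter_upwards [hA f, h1, Lp.coeFn_sub (A f)
      (∑ q : Fin m × ι, inner ℂ (stepKernel κ m q) f • cellFun X m q),
    Lp.coeFn_finsetSum Finset.univ
      (fun q : Fin m × ι => inner ℂ (stepKernel κ m q) f • cellFun X m q)] with x h2 h3 h4 h5
  rw [h4, Pi.sub_apply, h2, h5, Finset.sum_apply]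
  simp only [h3]
  ext a
  rw [Fintype.sum_prod_type]
  simp only [PiLp.sub_apply, stepError, inner_sub_left, sum_inner, WithLp.ofLp_sum,
    Finset.sum_apply, stepKernel]
  congr 1
  refine Finset.sum_congr rfl fun p _ => ?_
  by_cases hx : x ∈ Ioc (node X m p) (node X m (p + 1))
  · simp [indicator_of_mem hx]
  · simp [indicator_of_notMem hx]

/-- An operator with a continuous kernel is approximated in the Hilbert-Schmidt norm by freezing
the kernel on the cells of a fine partition. -/
theorem HasKernel.exists_hilbertSchmidtBound_step [DecidableEq ι] (hX : 0 < X)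
    {A : L2Space X ι →L[ℂ] L2Space X ι} {κ : ι → ℝ → L2Space X ι} (hA : HasKernel A κ)
    (hκ : ∀ a, ContinuousOn (κ a) (Icc 0 X)) {ε : ℝ} (hε : 0 < ε) :
    ∃ m : ℕ, HilbertSchmidtBound (A - finiteRankOp (stepKernel κ m) (cellFun X m)) (ε ^ 2) := by
  -- `δ` makes the bound `X |ι| δ²` of `HasKernel.hilbertSchmidtBound` at most `ε²`
  set δ : ℝ := ε / √(X * Fintype.card ι + 1) with hδ
  have hpos : 0 < X * Fintype.card ι + 1 := by positivity
  have hδ0 : 0 < δ := by positivity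
  have hu : ∀ a, ∃ η > 0, ∀ x ∈ Icc 0 X, ∀ y ∈ Icc 0 X, dist x y < η →
      dist (κ a x) (κ a y) < δ := fun a =>
    Metric.uniformContinuousOn_iff.1 (isCompact_Icc.uniformContinuousOn_of_continuous (hκ a)) δ hδ0
  choose η hη0 hη using hu
  have hm : ∃ m : ℕ, 0 < m ∧ ∀ a, X / m < η a := by
    have h1 : Tendsto (fun m : ℕ => X / m) atTop (𝓝 0) := tendsto_const_div_atTop_nhds_zero_nat X
    have h2 : ∀ᶠ m : ℕ in atTop, ∀ a, X / m < η a :=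
      eventually_all.2 fun a => h1.eventually_lt_const (hη0 a)
    obtain ⟨m, h3, h4⟩ := (h2.and (eventually_gt_atTop 0)).exists
    exact ⟨m, h4, h3⟩
  obtain ⟨m, hm0, hm⟩ := hm
  refine ⟨m, fun n e he => ((hA.sub_finiteRankOp m).hilbertSchmidtBound hX.le (C := δ) ?_ n e
    he).trans ?_⟩
  · intro a x hx
    obtain ⟨p, hp⟩ := exists_cell hX hm0 hx
    have hxp := (hp p).2 rfl
    have hsum : ∑ p' : Fin m, (Ioc (node X m p') (node X m (p' + 1))).indicator
        (fun _ => κ a (node X m p')) x = κ a (node X m p) := by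
      rw [Finset.sum_eq_single p]
      · exact indicator_of_mem hxp _
      · intro p' _ hne
        exact indicator_of_notMem (fun h => hne ((hp p').1 h)) _
      · intro h; exact absurd (Finset.mem_univ _) h
    rw [stepError, hsum, ← dist_eq_norm]
    refine (hη a x (Ioc_subset_Icc_self hx) _ (node_mem hX.le p.2.le) ?_).le
    rw [Real.dist_eq, abs_of_pos (sub_pos.2 hxp.1)]
    refine lt_of_le_of_lt ?_ (hm a)
    have h2 : node X m (p + 1) = node X m p + X / m := by
      unfold node; push_cast; ring
    linarith [hxp.2]
  · rw [hδ, div_pow, Real.sq_sqrt hpos.le, ← mul_assoc, mul_div_assoc', div_le_iff₀ hpos]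
    nlinarith [sq_nonneg ε]

/-- If `D` is a causal strict contraction, then `(1 - D)⁻¹` is causal. -/
theorem cutoff_eq_zero_of_sub_eq {D : L2Space X ι →L[ℂ] L2Space X ι} (hD : ‖D‖ < 1) {t : ℝ}
    (hc : ∀ f, cutoff X ι t f = 0 → cutoff X ι t (D f) = 0) {ψ φ : L2Space X ι}
    (h : ψ - D ψ = φ) (hφ : cutoff X ι t φ = 0) : cutoff X ι t ψ = 0 := by
  set y := cutoff X ι t ψ with hy
  have h1 : cutoff X ι t (D (ψ - y)) = 0 := by
    apply hc
    rw [map_sub, hy, cutoff_cutoff, min_self, sub_self]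
  have h2 : y = cutoff X ι t (D y) := by
    rw [← h, map_sub, sub_eq_zero] at hφ
    rw [map_sub, map_sub, sub_eq_zero] at h1
    rw [← h1, ← hφ]
  by_contra hne
  have h3 : ‖y‖ ≤ ‖D‖ * ‖y‖ := by
    conv_lhs => rw [h2]
    exact (norm_cutoff_apply_le t _).trans (D.le_opNorm y)
  nlinarith [norm_pos_iff.2 hne]

/-- The kernel `κ` is of Volterra type: `κ a x` vanishes beyond `x`. -/
def IsVolterraKernel (κ : ι → ℝ → L2Space X ι) : Prop :=
  ∀ a, ∀ x ∈ Icc 0 X, cutoff X ι x (κ a x) = κ a x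

theorem IsVolterraKernel.cutoff_of_le {κ : ι → ℝ → L2Space X ι} (hv : IsVolterraKernel κ) (a : ι)
    {x t : ℝ} (hx : x ∈ Icc 0 X) (hxt : x ≤ t) : cutoff X ι t (κ a x) = κ a x := by
  rw [← hv a x hx, cutoff_cutoff, min_eq_right hxt]

theorem IsVolterraKernel.causal_step [DecidableEq ι] (hX : 0 ≤ X) {κ : ι → ℝ → L2Space X ι}
    (hv : IsVolterraKernel κ) {A : L2Space X ι →L[ℂ] L2Space X ι} (hA : HasKernel A κ) (m : ℕ)
    (t : ℝ) (f : L2Space X ι) (hf : cutoff X ι t f = 0) :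
    cutoff X ι t ((A - finiteRankOp (stepKernel κ m) (cellFun X m)) f) = 0 := by
  apply Lp.ext
  filter_upwards [coeFn_cutoff t ((A - finiteRankOp (stepKernel κ m) (cellFun X m)) f),
    hA.sub_finiteRankOp m f, ae_restrict_mem measurableSet_Ioc,
    Lp.coeFn_zero (EuclideanSpace ℂ ι) 2 (volume.restrict (Ioc 0 X))] with x h1 h2 hx h3
  rw [h1, h3]
  by_cases hxt : x ∈ Ioc 0 t
  · rw [indicator_of_mem hxt, h2]
    ext a
    have h4 : cutoff X ι t (stepError κ m a x) = stepError κ m a x := by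
      rw [stepError, map_sub, hv.cutoff_of_le a (Ioc_subset_Icc_self hx) hxt.2, map_sum]
      congr 1
      refine Finset.sum_congr rfl fun p _ => ?_
      by_cases hp : x ∈ Ioc (node X m p) (node X m (p + 1))
      · rw [indicator_of_mem hp]
        exact hv.cutoff_of_le a (node_mem hX p.2.le) (hp.1.le.trans hxt.2)
      · rw [indicator_of_notMem hp, map_zero]
    simp only [Pi.zero_apply, PiLp.zero_apply]
    rw [← h4, inner_cutoff_left, hf, inner_zero_right]
  · rw [indicator_of_notMem hxt]
    rfl

theorem cutoff_cellFun [DecidableEq ι] (m : ℕ) (q : Fin m × ι) {t : ℝ} (ht : t ≤ node X m q.1) :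
    cutoff X ι t (cellFun X m q) = 0 := by
  apply Lp.ext
  filter_upwards [coeFn_cutoff t (cellFun X m q),
    coeFn_cellFun m q,
    Lp.coeFn_zero (EuclideanSpace ℂ ι) 2 (volume.restrict (Ioc 0 X))] with x h1 h2 h3
  rw [h1, h3]
  by_cases hxt : x ∈ Ioc 0 t
  · rw [indicator_of_mem hxt, h2, indicator_of_notMem fun h => absurd (h.1.trans_le hxt.2)
      (not_lt.2 ht)]
    rfl
  · rw [indicator_of_notMem hxt]
    rfl

/-- The perturbation determinant of the step approximation of a Volterra operator relative to the
remainder `D` is `1`: since `(1 - D)⁻¹` is causal, the matrix is strictly block triangular. -/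
theorem IsVolterraKernel.det_step [DecidableEq ι] (hX : 0 ≤ X) {κ : ι → ℝ → L2Space X ι}
    (hv : IsVolterraKernel κ) {A : L2Space X ι →L[ℂ] L2Space X ι} (hA : HasKernel A κ) (m : ℕ)
    (hD : ‖A - finiteRankOp (stepKernel κ m) (cellFun X m)‖ < 1) (ψ : Fin m × ι → L2Space X ι)
    (hψ : ∀ q, ψ q - (A - finiteRankOp (stepKernel κ m) (cellFun X m)) (ψ q) = cellFun X m q) :
    (1 - Matrix.of fun i j => inner ℂ (stepKernel κ m i) (ψ j)).det = 1 := by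
  have hzero : ∀ i j : Fin m × ι, i.1 ≤ j.1 → inner ℂ (stepKernel κ m i) (ψ j) = 0 := by
    intro i j hij
    have hle : node X m i.1 ≤ node X m j.1 := node_mono hX m hij
    have h1 : cutoff X ι (node X m i.1) (ψ j) = 0 :=
      cutoff_eq_zero_of_sub_eq hD (hv.causal_step hX hA m _) (hψ j) (cutoff_cellFun m j hle)
    rw [stepKernel, ← hv _ _ (node_mem hX i.1.2.le), inner_cutoff_left, h1, inner_zero_right]
  set N : Matrix (Fin m × ι) (Fin m × ι) ℂ :=
    1 - Matrix.of fun i j => inner ℂ (stepKernel κ m i) (ψ j) with hN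
  have hNij : ∀ i j : Fin m × ι, i.1 ≤ j.1 → N i j = (1 : Matrix _ _ ℂ) i j := fun i j hij => by
    rw [hN, Matrix.sub_apply, Matrix.of_apply, hzero i j hij, sub_zero]
  rw [← Matrix.det_transpose]
  have hbt : Nᵀ.BlockTriangular Prod.fst := fun i j hij => by
    rw [Matrix.transpose_apply, hNij j i hij.le, Matrix.one_apply_ne]
    rintro rfl
    exact lt_irrefl _ hij
  rw [hbt.det_fintype]
  refine Finset.prod_eq_one fun k _ => ?_
  have : Nᵀ.toSquareBlock Prod.fst k = 1 := by
    ext i j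
    rw [Matrix.toSquareBlock_def, Matrix.of_apply, Matrix.transpose_apply,
      hNij _ _ (by rw [i.2, j.2])]
    simp only [Matrix.one_apply, Subtype.ext_iff, eq_comm]
  rw [this, Matrix.det_one]

theorem IsVolterraKernel.sum_inner_step [DecidableEq ι] (hX : 0 ≤ X) {κ : ι → ℝ → L2Space X ι}
    (hv : IsVolterraKernel κ) (m : ℕ) :
    ∑ i, inner ℂ (stepKernel κ m i) (cellFun X m i) = 0 := by
  refine Finset.sum_eq_zero fun i _ => ?_
  rw [stepKernel, ← hv _ _ (node_mem hX i.1.2.le), inner_cutoff_left, cutoff_cellFun m i le_rfl,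
    inner_zero_right]

theorem HasKernel.exists_finiteRankOp_approx [DecidableEq ι] (hX : 0 < X)
    {A : L2Space X ι →L[ℂ] L2Space X ι} {κ : ι → ℝ → L2Space X ι} (hA : HasKernel A κ)
    (hκ : ∀ a, ContinuousOn (κ a) (Icc 0 X)) (ε : ℝ) (hε : 0 < ε) :
    ∃ (q : Type) (_ : Fintype q) (k φ : q → L2Space X ι), ‖A - finiteRankOp k φ‖ ≤ ε := by
  obtain ⟨m, hm⟩ := hA.exists_hilbertSchmidtBound_step hX hκ hε
  exact ⟨_, inferInstance, _, _, hm.opNorm_le hε.le⟩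

theorem exists_solution_of_isUnit {D : L2Space X ι →L[ℂ] L2Space X ι} (h : IsUnit (1 - D))
    (φ : L2Space X ι) : ∃ ψ, ψ - D ψ = φ := by
  obtain ⟨ψ, hψ⟩ := (ContinuousLinearMap.isUnit_iff_bijective.1 h).2 φ
  exact ⟨ψ, hψ⟩

/-- `1` is not in the spectrum of a Volterra operator: it is a small remainder plus a finite-rank
operator whose perturbation determinant is `1`. -/
theorem IsVolterraKernel.isUnit_one_sub [DecidableEq ι] (hX : 0 < X) {κ : ι → ℝ → L2Space X ι}
    (hv : IsVolterraKernel κ) (hκ : ∀ a, ContinuousOn (κ a) (Icc 0 X))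
    {A : L2Space X ι →L[ℂ] L2Space X ι} (hA : HasKernel A κ) : IsUnit (1 - A) := by
  obtain ⟨m, hm⟩ := hA.exists_hilbertSchmidtBound_step hX hκ (ε := 1 / 2) (by norm_num)
  have hD := hm.isUnit_one_sub (by norm_num) (by norm_num)
  choose ψ hψ using fun q => exists_solution_of_isUnit hD (cellFun X m q)
  have hlt := (hm.opNorm_le (by norm_num)).trans_lt (by norm_num : (1 / 2 : ℝ) < 1)
  have := isUnit_one_sub_add_finiteRankOp hD (stepKernel κ m) (cellFun X m) ψ hψ
    (by rw [hv.det_step hX.le hA m hlt ψ hψ]; exact one_ne_zero)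
  rwa [sub_add_cancel] at this

/-- The 2-modified determinant of a Volterra operator is `1`. -/
theorem IsVolterraKernel.tendsto_finiteDet₂_galerkin [DecidableEq ι] (hX : 0 < X)
    {κ : ι → ℝ → L2Space X ι} (hv : IsVolterraKernel κ) (hκ : ∀ a, ContinuousOn (κ a) (Icc 0 X))
    {A : L2Space X ι →L[ℂ] L2Space X ι} (hA : HasKernel A κ)
    {V : ℕ → Submodule ℂ (L2Space X ι)} [∀ J, FiniteDimensional ℂ (V J)]
    (hV : ∀ x, Tendsto (fun J => (V J).starProjection x) atTop (𝓝 x)) :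
    Tendsto (fun J => finiteDet₂ (galerkin A (V J))) atTop (𝓝 1) := by
  have hAP := tendsto_starProjection_comp hV (hA.exists_finiteRankOp_approx hX hκ)
  rw [Metric.tendsto_atTop]
  intro η hη
  -- the remainder contributes a factor within `e ^ (3 ε²) - 1 < η / 2` of `1`
  obtain ⟨ε, hε0, hε1, hεη⟩ : ∃ ε : ℝ, 0 < ε ∧ ε < 1 ∧ Real.exp (3 * ε ^ 2) - 1 < η / 2 := by
    have h1 : Tendsto (fun ε : ℝ => Real.exp (3 * ε ^ 2) - 1) (𝓝[>] 0) (𝓝 0) := by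
      have : Continuous fun ε : ℝ => Real.exp (3 * ε ^ 2) - 1 := by fun_prop
      simpa using (this.tendsto 0).mono_left nhdsWithin_le_nhds
    obtain ⟨ε, h2, h3, h4⟩ := ((h1.eventually_lt_const (half_pos hη)).and
      ((eventually_mem_nhdsWithin (α := ℝ)).and
        (nhdsWithin_le_nhds (Iio_mem_nhds zero_lt_one)))).exists
    exact ⟨ε, h3, h4, h2⟩
  obtain ⟨m, hm⟩ := hA.exists_hilbertSchmidtBound_step hX hκ hε0
  set D := A - finiteRankOp (stepKernel κ m) (cellFun X m) with hDdef
  have hD := hm.isUnit_one_sub hε0.le hε1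
  choose ψ hψ using fun q => exists_solution_of_isUnit hD (cellFun X m q)
  have hlt : ‖D‖ < 1 := (hm.opNorm_le hε0.le).trans_lt hε1
  have hDP : Tendsto (fun J => (V J).starProjection ∘L D) atTop (𝓝 D) := by
    simp only [hDdef, ContinuousLinearMap.comp_sub]
    exact hAP.sub (tendsto_starProjection_comp_finiteRankOp hV _ _)
  obtain ⟨r, hr, hr1⟩ := exists_tendsto_finiteDet₂_galerkin_add hV hDP hD (stepKernel κ m)
    (cellFun X m) ψ hψ
  rw [hv.det_step hX.le hA m hlt ψ hψ, hv.sum_inner_step hX.le m, Complex.exp_zero, one_mul] at hr1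
  have hAD : D + finiteRankOp (stepKernel κ m) (cellFun X m) = A := sub_add_cancel _ _
  rw [hAD] at hr
  have hB : ∀ J, ‖finiteDet₂ (galerkin D (V J)) - 1‖ < η / 2 := fun J =>
    (hm.norm_finiteDet₂_galerkin_sub_one_le (by nlinarith) (V J)).trans_lt hεη
  have hsmall : ∀ᶠ J in atTop, (1 + η / 2) * ‖r J - 1‖ < η / 2 := by
    have h1 : Tendsto (fun J => (1 + η / 2) * ‖r J - 1‖) atTop (𝓝 ((1 + η / 2) * ‖(1 : ℂ) - 1‖)) :=
      ((hr1.sub tendsto_const_nhds).norm).const_mul _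
    rw [sub_self, norm_zero, mul_zero] at h1
    exact h1.eventually_lt_const (half_pos hη)
  obtain ⟨N, hN⟩ := eventually_atTop.1 (hr.and hsmall)
  refine ⟨N, fun J hJ => ?_⟩
  obtain ⟨h1, h2⟩ := hN J hJ
  rw [h1, dist_eq_norm]
  set d := finiteDet₂ (galerkin D (V J))
  have h3 : d * r J - 1 = d * (r J - 1) + (d - 1) := by ring
  have h4 : ‖d‖ ≤ 1 + η / 2 := by
    calc ‖d‖ = ‖1 + (d - 1)‖ := by ring_nf
      _ ≤ 1 + η / 2 := (norm_add_le _ _).trans (by rw [norm_one]; linarith [hB J])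
  rw [h3]
  calc _ ≤ ‖d‖ * ‖r J - 1‖ + ‖d - 1‖ := (norm_add_le _ _).trans (by rw [norm_mul])
    _ ≤ (1 + η / 2) * ‖r J - 1‖ + ‖d - 1‖ := by gcongr
    _ < η := by linarith [hB J]

end Volterra

/-! ### The periodic resolvent composed with a square integrable coefficient -/

theorem continuous_exp_single {ι : Type} [DecidableEq ι] (a : ι) :
    Continuous fun x : ℝ => (EuclideanSpace.single a (Complex.exp x) : EuclideanSpace ℂ ι) := by
  refine (PiLp.continuous_toLp 2 _).comp (continuous_pi fun b => ?_)
  by_cases h : b = a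
  · subst h; simp only [Pi.single_eq_same]; fun_prop
  · simp only [Pi.single_eq_of_ne h]; fun_prop

section BirmanSchwinger

variable {X : ℝ} {ι : Type} [Fintype ι] [DecidableEq ι] {M : ℝ → Matrix ι ι ℂ}

theorem MemL2.memLp_row (hM : MemL2 X M) (a : ι) :
    MemLp (fun y => WithLp.toLp 2 fun b =>
      starRingEnd ℂ (Complex.exp (-y) * (M y a b - (1 : Matrix ι ι ℂ) a b)) :
        ℝ → EuclideanSpace ℂ ι) 2 (volume.restrict (Ioc 0 X)) := by
  refine MemLp.of_eval_piLp fun b => ?_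
  have h1 : MemLp (fun y => M y a b - (1 : Matrix ι ι ℂ) a b) 2 (volume.restrict (Ioc 0 X)) :=
    (hM a b).sub (memLp_const _)
  have h2 : Continuous fun y : ℝ => Complex.exp (-(y : ℂ)) := by fun_prop
  refine h1.of_le_mul (c := 1) ?_ ?_
  · exact Complex.continuous_conj.comp_aestronglyMeasurable
      (h2.aestronglyMeasurable.mul h1.aestronglyMeasurable)
  · filter_upwards [ae_restrict_mem measurableSet_Ioc] with y hy
    simp only [RCLike.norm_conj, norm_mul]
    refine mul_le_mul_of_nonneg_right ?_ (norm_nonneg _)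
    rw [← Complex.ofReal_neg, Complex.norm_exp_ofReal]
    exact Real.exp_le_one_iff.2 (by linarith [hy.1])

/-- The row vector `y ↦ conj (e ^ (-y) (M y - 1))` with index `a`: pairing with it integrates
`e ^ (-y) ((M - 1) f)ₐ`. -/
noncomputable def MemL2.row (hM : MemL2 X M) (a : ι) : L2Space X ι := (hM.memLp_row a).toLp _

theorem MemL2.inner_row_ae (hM : MemL2 X M) (a : ι) (f : ℝ → EuclideanSpace ℂ ι) :
    ∀ᵐ y ∂volume.restrict (Ioc 0 X), inner ℂ (hM.row a y) (f y) =
      Complex.exp (-y) * ((M y - 1) *ᵥ (f y).ofLp) a := by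
  filter_upwards [MemLp.coeFn_toLp (hM.memLp_row a)] with y hy
  change inner ℂ ((hM.memLp_row a).toLp _ y) (f y) = _
  rw [hy, PiLp.inner_apply, Matrix.mulVec, dotProduct, Finset.mul_sum]
  refine Finset.sum_congr rfl fun b _ => ?_
  simp only [RCLike.inner_apply, RingHomCompTriple.comp_apply, RingHom.id_apply,
    Matrix.sub_apply]
  ring

theorem MemL2.inner_cutoff_row (hM : MemL2 X M) (a : ι) (f : L2Space X ι) {t : ℝ}
    (ht : t ∈ Icc 0 X) : inner ℂ (cutoff X ι t (hM.row a)) f =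
      ∫ y in (0 : ℝ)..t, Complex.exp (-y) * ((M y - 1) *ᵥ (f y).ofLp) a := by
  rw [inner_cutoff ht, intervalIntegral.integral_of_le ht.1, intervalIntegral.integral_of_le ht.1]
  exact integral_congr_ae
    (ae_restrict_of_ae_restrict_of_subset (Ioc_subset_Ioc_right ht.2) (hM.inner_row_ae a f))

theorem MemL2.inner_row (hX : 0 ≤ X) (hM : MemL2 X M) (a : ι) (f : L2Space X ι) :
    inner ℂ (hM.row a) f =
      ∫ y in (0 : ℝ)..X, Complex.exp (-y) * ((M y - 1) *ᵥ (f y).ofLp) a := by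
  rw [← hM.inner_cutoff_row a f ⟨hX, le_rfl⟩, cutoff_self]

theorem MemL2.intervalIntegrable_mulVec (hX : 0 ≤ X) (hM : MemL2 X M) (a : ι)
    (f : L2Space X ι) :
    IntervalIntegrable (fun y => ((M y - 1) *ᵥ (f y).ofLp) a) volume 0 X := by
  have h1 : IntervalIntegrable (fun y => inner ℂ (hM.row a y) (f y)) volume 0 X :=
    (intervalIntegrable_iff_integrableOn_Ioc_of_le hX).2 (L2.integrable_inner _ _)
  have h2 : IntervalIntegrable (fun y : ℝ => Complex.exp y * inner ℂ (hM.row a y) (f y))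
      volume 0 X := h1.continuousOn_mul (by fun_prop)
  refine h2.congr_ae ?_
  rw [uIoc_of_le hX]
  filter_upwards [hM.inner_row_ae a f] with y hy
  rw [hy, ← mul_assoc, ← Complex.exp_add]
  simp

/-- The kernel of the Volterra part `f ↦ ∫₀ˣ e ^ (x - y) (M y - 1) f(y) dy`. -/
noncomputable def MemL2.volterraKernel (hM : MemL2 X M) (a : ι) (x : ℝ) : L2Space X ι :=
  starRingEnd ℂ (Complex.exp x) • cutoff X ι x (hM.row a)

theorem MemL2.inner_volterraKernel (hM : MemL2 X M) (a : ι) (f : L2Space X ι) {x : ℝ}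
    (hx : x ∈ Icc 0 X) : inner ℂ (hM.volterraKernel a x) f = Complex.exp x *
      ∫ y in (0 : ℝ)..x, Complex.exp (-y) * ((M y - 1) *ᵥ (f y).ofLp) a := by
  rw [volterraKernel, inner_smul_left, hM.inner_cutoff_row a f hx, RCLike.conj_conj]

theorem MemL2.continuousOn_volterraKernel (hM : MemL2 X M) (a : ι) :
    ContinuousOn (hM.volterraKernel a) (Icc 0 X) := by
  have h : Continuous fun x : ℝ => starRingEnd ℂ (Complex.exp x) := by fun_prop
  exact h.continuousOn.smul (continuousOn_cutoff _)

theorem MemL2.isVolterraKernel (hM : MemL2 X M) : IsVolterraKernel hM.volterraKernel :=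
  fun a x _ => by rw [volterraKernel, map_smul, cutoff_cutoff, min_self]

/-- The solution `e ^ x δ_a` of `u' = u`. -/
noncomputable def expVec (X : ℝ) (a : ι) : L2Space X ι :=
  (memLp_of_continuousOn (continuous_exp_single a).continuousOn).toLp _

theorem coeFn_expVec (a : ι) : expVec X a =ᵐ[volume.restrict (Ioc 0 X)]
    fun x : ℝ => (EuclideanSpace.single a (Complex.exp x) : EuclideanSpace ℂ ι) :=
  MemLp.coeFn_toLp (memLp_of_continuousOn (continuous_exp_single a).continuousOn)

/-- The coefficient `e ^ X / (1 - e ^ X)` of the finite-rank part of the periodic Green's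
function. -/
noncomputable def greenCoeff (X : ℝ) : ℂ := Complex.exp X / (1 - Complex.exp X)

theorem exp_sub_one_ne_zero (hX : 0 < X) : Complex.exp X - 1 ≠ 0 := by
  rw [sub_ne_zero, ← Complex.ofReal_exp, ← Complex.ofReal_one]
  exact fun h => (Real.one_lt_exp_iff.2 hX).ne' (Complex.ofReal_injective h)

/-- The finite-rank part of `(∂ₓ - 1)⁻¹ (M - 1)`, which restores periodicity. -/
noncomputable def MemL2.boundaryOp (hM : MemL2 X M) : L2Space X ι →L[ℂ] L2Space X ι :=
  finiteRankOp (fun a => starRingEnd ℂ (greenCoeff X) • hM.row a) (expVec X)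

/-- The kernel of `(∂ₓ - 1)⁻¹ (M - 1)`. -/
noncomputable def MemL2.periodicKernel (hM : MemL2 X M) (a : ι) (x : ℝ) : L2Space X ι :=
  starRingEnd ℂ (Complex.exp x) •
    (cutoff X ι x (hM.row a) + starRingEnd ℂ (greenCoeff X) • hM.row a)

theorem MemL2.inner_periodicKernel (hM : MemL2 X M) (a : ι) (f : L2Space X ι) {x : ℝ}
    (hx : x ∈ Icc 0 X) : inner ℂ (hM.periodicKernel a x) f = Complex.exp x *
      (greenCoeff X * (∫ y in (0 : ℝ)..X, Complex.exp (-y) * ((M y - 1) *ᵥ (f y).ofLp) a) +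
        ∫ y in (0 : ℝ)..x, Complex.exp (-y) * ((M y - 1) *ᵥ (f y).ofLp) a) := by
  rw [periodicKernel, inner_smul_left, inner_add_left, inner_smul_left,
    hM.inner_cutoff_row a f hx, hM.inner_row (hx.1.trans hx.2), RCLike.conj_conj, RCLike.conj_conj,
    add_comm]

theorem MemL2.hasKernel_add_boundaryOp (hM : MemL2 X M) {A : L2Space X ι →L[ℂ] L2Space X ι}
    (hA : HasKernel A hM.volterraKernel) : HasKernel (A + hM.boundaryOp) hM.periodicKernel := by
  intro f
  rw [add_apply, boundaryOp, finiteRankOp_apply]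
  have h1 : ∀ᵐ x ∂volume.restrict (Ioc 0 X), ∀ a : ι,
      (inner ℂ (starRingEnd ℂ (greenCoeff X) • hM.row a) f • expVec X a : L2Space X ι) x =
        inner ℂ (starRingEnd ℂ (greenCoeff X) • hM.row a) f •
          EuclideanSpace.single a (Complex.exp x) := by
    refine ae_all_iff.2 fun a => ?_
    filter_upwards [Lp.coeFn_smul (inner ℂ (starRingEnd ℂ (greenCoeff X) • hM.row a) f)
      (expVec X a), coeFn_expVec (X := X) a] with x h2 h3
    rw [h2, Pi.smul_apply, h3]
  filter_upwards [hA f, h1, Lp.coeFn_add (A f)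
      (∑ a, inner ℂ (starRingEnd ℂ (greenCoeff X) • hM.row a) f • expVec X a),
    Lp.coeFn_finsetSum Finset.univ
      (fun a => inner ℂ (starRingEnd ℂ (greenCoeff X) • hM.row a) f • expVec X a)]
    with x h2 h3 h4 h5
  rw [h4, Pi.add_apply, h2, h5, Finset.sum_apply]
  simp only [h3]
  ext a
  simp only [PiLp.add_apply, WithLp.ofLp_sum, Finset.sum_apply, PiLp.smul_apply,
    PiLp.single_apply, smul_eq_mul, mul_ite, mul_zero, Finset.sum_ite_eq,
    Finset.mem_univ, if_true, volterraKernel, periodicKernel, smul_add, inner_add_left,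
    inner_smul_left, RCLike.conj_conj]
  ring

theorem MemL2.isPeriodicSolution (hX : 0 < X) (hM : MemL2 X M) (f : L2Space X ι) :
    IsPeriodicSolution X (fun t => WithLp.toLp 2 ((M t - 1) *ᵥ (f t).ofLp))
      (fun x => WithLp.toLp 2 fun a => inner ℂ (hM.periodicKernel a x) f) := by
  have h0 : (0 : ℝ) ∈ Icc 0 X := ⟨le_rfl, hX.le⟩
  have hXm : X ∈ Icc 0 X := ⟨hX.le, le_rfl⟩
  have hu0 : ∀ a, inner ℂ (hM.periodicKernel a 0) f = greenCoeff X *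
      ∫ y in (0 : ℝ)..X, Complex.exp (-y) * ((M y - 1) *ᵥ (f y).ofLp) a := fun a => by
    rw [hM.inner_periodicKernel a f h0]; simp
  have hode := fun a => (integrated_ode_iff hX.le (u := fun x => inner ℂ (hM.periodicKernel a x) f)
    (inner ℂ (hM.periodicKernel a 0) f) (hM.intervalIntegrable_mulVec hX.le a f)).2
    (fun x hx => by rw [hM.inner_periodicKernel a f hx, hu0])
  refine ⟨?_, ?_, fun x hx a => (hode a).2 x hx⟩
  · exact (PiLp.continuous_toLp 2 _).comp_continuousOn (continuousOn_pi.2 fun a => (hode a).1)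
  · ext a
    simp only
    rw [hu0, hM.inner_periodicKernel a f hXm, greenCoeff]
    have h1 : (1 : ℂ) - Complex.exp X ≠ 0 := by
      rw [← neg_ne_zero, neg_sub]; exact exp_sub_one_ne_zero hX
    field_simp
    ring

theorem MemL2.eq_of_isPeriodicSolution (hX : 0 < X) (hM : MemL2 X M) (f : L2Space X ι)
    {u : ℝ → EuclideanSpace ℂ ι}
    (hu : IsPeriodicSolution X (fun t => WithLp.toLp 2 ((M t - 1) *ᵥ (f t).ofLp)) u) {x : ℝ}
    (hx : x ∈ Icc 0 X) : u x = WithLp.toLp 2 fun a => inner ℂ (hM.periodicKernel a x) f := by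
  obtain ⟨hc, hper, hode⟩ := hu
  ext a
  have hsol := (integrated_ode_iff hX.le (u := fun x => u x a) (u 0 a)
    (hM.intervalIntegrable_mulVec hX.le a f)).1
    ⟨((PiLp.continuous_apply 2 _ a).comp_continuousOn hc), fun x hx => hode x hx a⟩
  have hend := hsol X ⟨hX.le, le_rfl⟩
  simp only at hend hsol
  rw [← hper] at hend
  have h1 : (1 : ℂ) - Complex.exp X ≠ 0 := by
    rw [← neg_ne_zero, neg_sub]; exact exp_sub_one_ne_zero hX
  have hu0 : u 0 a = greenCoeff X *
      ∫ y in (0 : ℝ)..X, Complex.exp (-y) * ((M y - 1) *ᵥ (f y).ofLp) a := by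
    rw [greenCoeff, div_mul_eq_mul_div, eq_div_iff h1]
    linear_combination hend
  simp only
  rw [hM.inner_periodicKernel a f hx, hsol x hx, hu0]

/-- A decomposition of `(∂ₓ - 1)⁻¹ (M - 1)` into a Volterra operator and `boundaryOp`. -/
theorem MemL2.exists_volterra (hX : 0 < X) (hM : MemL2 X M) :
    ∃ A, HasKernel A hM.volterraKernel ∧ IsBirmanSchwinger X M (A + hM.boundaryOp) := by
  obtain ⟨A, hA⟩ := exists_hasKernel hX.le hM.volterraKernel hM.continuousOn_volterraKernel
  exact ⟨A, hA, fun f => ⟨_, hM.isPeriodicSolution hX f, hM.hasKernel_add_boundaryOp hA f⟩⟩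

theorem IsBirmanSchwinger.hasKernel (hX : 0 < X) (hM : MemL2 X M)
    {K : L2Space X ι →L[ℂ] L2Space X ι} (hK : IsBirmanSchwinger X M K) :
    HasKernel K hM.periodicKernel := by
  intro f
  obtain ⟨u, hu, hKu⟩ := hK f
  filter_upwards [hKu, ae_restrict_mem measurableSet_Ioc] with x h1 h2
  rw [h1, hM.eq_of_isPeriodicSolution hX f hu (Ioc_subset_Icc_self h2)]

theorem MemL2.continuousOn_periodicKernel (hM : MemL2 X M) (a : ι) :
    ContinuousOn (hM.periodicKernel a) (Icc 0 X) := by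
  have h : Continuous fun x : ℝ => starRingEnd ℂ (Complex.exp x) := by fun_prop
  exact h.continuousOn.smul ((continuousOn_cutoff _).add continuousOn_const)

/-! ### The fundamental solution and the value of the determinant -/

theorem MemL2.exists_fundamentalSolution (hX : 0 < X) (hM : MemL2 X M) :
    ∃ Ψ, IsFundamentalSolution X M Ψ := by
  obtain ⟨A, hA, -⟩ := hM.exists_volterra hX
  choose ψ hψ using fun b => exists_solution_of_isUnit
    (hM.isVolterraKernel.isUnit_one_sub hX hM.continuousOn_volterraKernel hA) (expVec X b)
  let Ψ : ℝ → Matrix ι ι ℂ := fun x => Matrix.of fun a b =>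
    (1 : Matrix ι ι ℂ) a b * Complex.exp x + inner ℂ (hM.volterraKernel a x) (ψ b)
  have hψΨ : ∀ b, ∀ᵐ x ∂volume.restrict (Ioc 0 X), ∀ a, ψ b x a = Ψ x a b := fun b => by
    have h1 : ψ b = expVec X b + A (ψ b) := by rw [← hψ b]; abel
    filter_upwards [hA (ψ b), Lp.coeFn_add (expVec X b) (A (ψ b)), coeFn_expVec (X := X) b]
      with x h2 h3 h4 a
    conv_lhs => rw [h1, h3, Pi.add_apply, h2, h4]
    simp [Ψ, Matrix.one_apply]
  have hode := fun a b => (integrated_ode_iff hX.le (u := fun x => Ψ x a b)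
    ((1 : Matrix ι ι ℂ) a b) (hM.intervalIntegrable_mulVec hX.le a (ψ b))).2 (fun x hx => by
      change (1 : Matrix ι ι ℂ) a b * Complex.exp x + inner ℂ (hM.volterraKernel a x) (ψ b) = _
      rw [hM.inner_volterraKernel a (ψ b) hx]
      ring)
  refine ⟨Ψ, ?_, fun x hx a b => ?_⟩
  · exact continuousOn_pi.2 fun a => continuousOn_pi.2 fun b => (hode a b).1
  · rw [(hode a b).2 x hx, intervalIntegral.integral_of_le hx.1,
      intervalIntegral.integral_of_le hx.1]
    congr 1
    refine integral_congr_ae ?_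
    filter_upwards [ae_restrict_of_ae_restrict_of_subset (Ioc_subset_Ioc_right hx.2) (hψΨ b)]
      with t ht
    have h5 : (ψ b t).ofLp = fun a => Ψ t a b := funext ht
    rw [h5, Matrix.sub_mulVec, Matrix.one_mulVec, Pi.sub_apply, add_sub_cancel]
    rfl

/-- Column `b` of a fundamental solution, as an element of `L²`. -/
theorem IsFundamentalSolution.memLp_col {Ψ : ℝ → Matrix ι ι ℂ}
    (hΨ : IsFundamentalSolution X M Ψ) (b : ι) :
    MemLp (fun x => WithLp.toLp 2 fun a => Ψ x a b : ℝ → EuclideanSpace ℂ ι) 2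
      (volume.restrict (Ioc 0 X)) :=
  memLp_of_continuousOn ((PiLp.continuous_toLp 2 _).comp_continuousOn
    (continuousOn_pi.2 fun a => continuousOn_pi.1 (continuousOn_pi.1 hΨ.1 a) b))

/-- Variation of constants for a fundamental solution, with `(M - 1) Ψ` as inhomogeneity. -/
theorem IsFundamentalSolution.eq_exp_mul (hX : 0 < X) (hM : MemL2 X M) {Ψ : ℝ → Matrix ι ι ℂ}
    (hΨ : IsFundamentalSolution X M Ψ) (a b : ι) {x : ℝ} (hx : x ∈ Icc 0 X) :
    Ψ x a b = Complex.exp x * ((1 : Matrix ι ι ℂ) a b + ∫ t in (0 : ℝ)..x, Complex.exp (-t) *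
      ((M t - 1) *ᵥ ((hΨ.memLp_col b).toLp _ t).ofLp) a) := by
  refine (integrated_ode_iff hX.le (u := fun x => Ψ x a b) _
    (hM.intervalIntegrable_mulVec hX.le a ((hΨ.memLp_col b).toLp _))).1
    ⟨continuousOn_pi.1 (continuousOn_pi.1 hΨ.1 a) b, fun x hx => ?_⟩ x hx
  rw [hΨ.2 x hx, intervalIntegral.integral_of_le hx.1, intervalIntegral.integral_of_le hx.1]
  congr 1
  refine integral_congr_ae ?_
  filter_upwards [ae_restrict_of_ae_restrict_of_subset (Ioc_subset_Ioc_right hx.2)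
    (MemLp.coeFn_toLp (hΨ.memLp_col b))] with t ht
  rw [ht, Matrix.sub_mulVec, Matrix.one_mulVec, Pi.sub_apply, add_sub_cancel]
  rfl

/-- The columns of `Ψ` are the images of the columns of `e ^ x I` under `(1 - V)⁻¹`. -/
theorem IsFundamentalSolution.col_sub (hX : 0 < X) (hM : MemL2 X M) {Ψ : ℝ → Matrix ι ι ℂ}
    (hΨ : IsFundamentalSolution X M Ψ) {A : L2Space X ι →L[ℂ] L2Space X ι}
    (hA : HasKernel A hM.volterraKernel) (b : ι) :
    (hΨ.memLp_col b).toLp _ - A ((hΨ.memLp_col b).toLp _) = expVec X b := by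
  apply Lp.ext
  filter_upwards [Lp.coeFn_sub ((hΨ.memLp_col b).toLp _) (A ((hΨ.memLp_col b).toLp _)),
    MemLp.coeFn_toLp (hΨ.memLp_col b), hA ((hΨ.memLp_col b).toLp _), coeFn_expVec (X := X) b,
    ae_restrict_mem measurableSet_Ioc] with x h1 h2 h3 h4 hx
  rw [h1, Pi.sub_apply, h2, h3, h4]
  ext a
  simp only [PiLp.sub_apply]
  rw [hM.inner_volterraKernel a _ (Ioc_subset_Icc_self hx),
    hΨ.eq_exp_mul hX hM a b (Ioc_subset_Icc_self hx)]
  simp only [PiLp.single_apply, Matrix.one_apply]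
  split_ifs <;> ring

/-- `1 - ⟪k_a, Ψ_b⟫ = (e ^ X - 1)⁻¹ (Ψ(X) - 1)` for the functionals `k_a` of the boundary part. -/
theorem IsFundamentalSolution.det_boundary (hX : 0 < X) (hM : MemL2 X M) {Ψ : ℝ → Matrix ι ι ℂ}
    (hΨ : IsFundamentalSolution X M Ψ) :
    (1 - Matrix.of fun a b => inner ℂ (starRingEnd ℂ (greenCoeff X) • hM.row a)
      ((hΨ.memLp_col b).toLp _)).det =
      (Complex.exp X - 1) ^ (-(Fintype.card ι : ℤ)) * (Ψ X - 1).det := by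
  have h1 : (1 : ℂ) - Complex.exp X ≠ 0 := by
    rw [← neg_ne_zero, neg_sub]; exact exp_sub_one_ne_zero hX
  have h2 := exp_sub_one_ne_zero hX
  have hmat : (1 - Matrix.of fun a b => inner ℂ (starRingEnd ℂ (greenCoeff X) • hM.row a)
      ((hΨ.memLp_col b).toLp _)) = (Complex.exp X - 1)⁻¹ • (Ψ X - 1) := by
    ext a b
    rw [Matrix.sub_apply, Matrix.of_apply, inner_smul_left, RCLike.conj_conj,
      hM.inner_row hX.le, Matrix.smul_apply, Matrix.sub_apply,
      hΨ.eq_exp_mul hX hM a b ⟨hX.le, le_rfl⟩, greenCoeff, smul_eq_mul]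
    set I := ∫ t in (0 : ℝ)..X, Complex.exp (-t) *
      ((M t - 1) *ᵥ ((hΨ.memLp_col b).toLp _ t).ofLp) a
    set d := (1 : Matrix ι ι ℂ) a b
    rw [eq_inv_mul_iff_mul_eq₀ h2]
    field_simp
    ring
  rw [hmat, Matrix.det_smul, zpow_neg, zpow_natCast, inv_pow]

theorem MemL2.exp_sum_inner_boundary (hX : 0 < X) (hM : MemL2 X M) :
    Complex.exp (∑ a, inner ℂ (starRingEnd ℂ (greenCoeff X) • hM.row a) (expVec X a)) =
      gammaFactor X M := by
  have hint : ∀ a, IntervalIntegrable (fun y => M y a a - 1) volume 0 X := fun a => by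
    rw [intervalIntegrable_iff_integrableOn_Ioc_of_le hX.le]
    exact ((hM a a).integrable one_le_two).sub (integrable_const _)
  have h1 : ∀ a, inner ℂ (starRingEnd ℂ (greenCoeff X) • hM.row a) (expVec X a) =
      greenCoeff X * ∫ y in (0 : ℝ)..X, (M y a a - 1) := fun a => by
    rw [inner_smul_left, RCLike.conj_conj, hM.inner_row hX.le,
      intervalIntegral.integral_of_le hX.le, intervalIntegral.integral_of_le hX.le]
    congr 1
    refine integral_congr_ae ?_
    filter_upwards [coeFn_expVec (X := X) a] with y hy
    rw [hy]
    have h2 : Complex.exp (-y) * Complex.exp y = 1 := by rw [← Complex.exp_add]; simp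
    rw [PiLp.ofLp_single, Matrix.mulVec_single]
    simp only [Pi.smul_apply, Matrix.col_apply, Matrix.sub_apply, Matrix.one_apply_eq,
      MulOpposite.smul_eq_mul_unop, MulOpposite.unop_op]
    linear_combination (M y a a - 1) * h2
  rw [gammaFactor]
  congr 1
  simp only [h1]
  rw [← Finset.mul_sum, ← intervalIntegral.integral_finsetSum fun a _ => hint a, greenCoeff]
  congr 1
  refine intervalIntegral.integral_congr fun y _ => ?_
  simp [Matrix.trace]

/-- `det₂ (I - K) = γ_M (e ^ X - 1) ^ (-d) det (Ψ(X) - I)` for a system of any size `d`. -/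
theorem IsBirmanSchwinger.hasDet₂ (hX : 0 < X) (hM : MemL2 X M)
    {K : L2Space X ι →L[ℂ] L2Space X ι} (hK : IsBirmanSchwinger X M K) {Ψ : ℝ → Matrix ι ι ℂ}
    (hΨ : IsFundamentalSolution X M Ψ) :
    HasDet₂ K (gammaFactor X M * (Complex.exp X - 1) ^ (-(Fintype.card ι : ℤ)) *
      (Ψ X - 1).det) := by
  intro V _ hmono hdense
  have hV := tendsto_starProjection hmono hdense
  obtain ⟨A, hA, hAK⟩ := hM.exists_volterra hX
  have hKA : K = A + hM.boundaryOp := (hK.hasKernel hX hM).unique (hAK.hasKernel hX hM)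
  have hAc := hM.continuousOn_volterraKernel
  obtain ⟨r, hr, hlim⟩ := exists_tendsto_finiteDet₂_galerkin_add hV
    (tendsto_starProjection_comp hV (hA.exists_finiteRankOp_approx hX hAc))
    (hM.isVolterraKernel.isUnit_one_sub hX hAc hA)
    (fun a => starRingEnd ℂ (greenCoeff X) • hM.row a) (expVec X)
    (fun b => (hΨ.memLp_col b).toLp _) (hΨ.col_sub hX hM hA)
  rw [hΨ.det_boundary hX hM, hM.exp_sum_inner_boundary hX] at hlim
  have hone := hM.isVolterraKernel.tendsto_finiteDet₂_galerkin hX hAc hA hV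
  have := (hone.mul hlim).congr' (hr.mono fun J hJ => hJ.symm)
  rw [hKA, mul_assoc, mul_comm (gammaFactor X M)]
  rwa [one_mul] at this

theorem MemL2.existsUnique_isBirmanSchwinger (hX : 0 < X) (hM : MemL2 X M) :
    ∃! K, IsBirmanSchwinger X M K := by
  obtain ⟨A, -, hAK⟩ := hM.exists_volterra hX
  exact ⟨_, hAK, fun K hK => (hK.hasKernel hX hM).unique (hAK.hasKernel hX hM)⟩

theorem IsBirmanSchwinger.isHilbertSchmidt (hX : 0 < X) (hM : MemL2 X M)
    {K : L2Space X ι →L[ℂ] L2Space X ι} (hK : IsBirmanSchwinger X M K) : IsHilbertSchmidt K :=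
  (hK.hasKernel hX hM).isHilbertSchmidt hX.le hM.continuousOn_periodicKernel

end BirmanSchwinger

/-! ### Fourier modes -/

section Fourier

/-- The frequency `2πij/X`. -/
noncomputable def freq (X : ℝ) (j : ℤ) : ℂ := 2 * Real.pi * Complex.I * j / X

theorem exp_freq_mul {X : ℝ} (hX : 0 < X) (j : ℤ) : Complex.exp (freq X j * X) = 1 := by
  have h : freq X j * X = j * (2 * Real.pi * Complex.I) := by
    have : (X : ℂ) ≠ 0 := by exact_mod_cast hX.ne'
    unfold freq; field_simp
  rw [h, Complex.exp_int_mul_two_pi_mul_I]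

theorem freq_sub (X : ℝ) (j k : ℤ) : freq X (j - k) = freq X j - freq X k := by
  unfold freq; push_cast; ring

theorem freq_eq_zero_iff {X : ℝ} (hX : 0 < X) {j : ℤ} : freq X j = 0 ↔ j = 0 := by
  have : (X : ℂ) ≠ 0 := by exact_mod_cast hX.ne'
  simp [freq, this, Real.pi_ne_zero]

theorem freq_sub_one_ne_zero (X : ℝ) (j : ℤ) : freq X j - 1 ≠ 0 := by
  have h : freq X j = ((2 * Real.pi * j / X : ℝ) : ℂ) * Complex.I := by
    unfold freq; push_cast; ring
  intro h0
  have := congrArg Complex.re h0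
  rw [h] at this
  simp [-Complex.ofReal_div, -Complex.ofReal_mul] at this

theorem conj_exp_freq_mul (X : ℝ) (j : ℤ) (x : ℝ) :
    starRingEnd ℂ (Complex.exp (freq X j * x)) = Complex.exp (-freq X j * x) := by
  rw [← Complex.exp_conj]
  congr 1
  have h2 : starRingEnd ℂ 2 = 2 := map_ofNat _ 2
  simp only [freq, map_mul, map_div₀, Complex.conj_ofReal, Complex.conj_I, map_intCast, h2]
  ring

theorem integral_exp_neg_freq {X : ℝ} (hX : 0 < X) (j : ℤ) :
    ∫ x in (0 : ℝ)..X, Complex.exp (-freq X j * x) = if j = 0 then (X : ℂ) else 0 := by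
  split_ifs with h
  · rw [(freq_eq_zero_iff hX).2 h]; simp
  · have h0 : -freq X j ≠ 0 := neg_ne_zero.2 fun h' => h ((freq_eq_zero_iff hX).1 h')
    have h1 := integral_mul_exp_mul (-freq X j) 0 X
    rw [intervalIntegral.integral_const_mul, neg_mul _ (X : ℂ), Complex.exp_neg,
      exp_freq_mul hX] at h1
    exact (mul_eq_zero.1 (h1.trans (by simp))).resolve_left h0

/-- The Fourier coefficients of the periodic solution of `u' - u = g`. -/
theorem integral_exp_neg_freq_mul_of_ode {X : ℝ} (hX : 0 < X) (j : ℤ) {u g : ℝ → ℂ}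
    (hu : ContinuousOn u (Icc 0 X)) (hg : IntervalIntegrable g volume 0 X) (hper : u 0 = u X)
    (hode : ∀ x ∈ Icc 0 X, u x = u 0 + ∫ t in (0 : ℝ)..x, (u t + g t)) :
    ∫ x in (0 : ℝ)..X, Complex.exp (-freq X j * x) * u x =
      (freq X j - 1)⁻¹ * ∫ x in (0 : ℝ)..X, Complex.exp (-freq X j * x) * g x := by
  have hui : IntervalIntegrable u volume 0 X :=
    (hu.mono (by rw [uIcc_of_le hX.le])).intervalIntegrable
  have hexp : Continuous fun t : ℝ => Complex.exp (-freq X j * (t : ℂ)) := by fun_prop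
  have hEu : IntervalIntegrable (fun t : ℝ => Complex.exp (-freq X j * t) * u t) volume 0 X :=
    hui.continuousOn_mul hexp.continuousOn
  have hEg : IntervalIntegrable (fun t : ℝ => Complex.exp (-freq X j * t) * g t) volume 0 X :=
    hg.continuousOn_mul hexp.continuousOn
  have hparts := integral_mul_exp_mul_primitive (-freq X j) hX.le (hui.add hg)
  have hend : ∫ s in (0 : ℝ)..X, (u s + g s) = 0 := by
    have := hode X ⟨hX.le, le_rfl⟩
    rw [← hper] at this
    linear_combination -this
  have hsplit : ∫ s in (0 : ℝ)..X, Complex.exp (-freq X j * s) * (u s + g s) =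
      (∫ s in (0 : ℝ)..X, Complex.exp (-freq X j * s) * u s) +
        ∫ s in (0 : ℝ)..X, Complex.exp (-freq X j * s) * g s := by
    rw [← intervalIntegral.integral_add hEu hEg]
    exact intervalIntegral.integral_congr fun t _ => mul_add _ _ _
  have hleft : ∫ t in (0 : ℝ)..X, -freq X j * Complex.exp (-freq X j * t) *
      ∫ s in (0 : ℝ)..t, (u s + g s) =
      -freq X j * ∫ t in (0 : ℝ)..X, Complex.exp (-freq X j * t) * u t := by
    have h0 : ∫ t in (0 : ℝ)..X, u 0 * (-freq X j * Complex.exp (-freq X j * t)) = 0 := by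
      rw [intervalIntegral.integral_const_mul, integral_mul_exp_mul, neg_mul _ (X : ℂ),
        Complex.exp_neg, exp_freq_mul hX]
      simp
    have hc0 : Continuous fun t : ℝ => u 0 * (-freq X j * Complex.exp (-freq X j * (t : ℂ))) := by
      fun_prop
    rw [← intervalIntegral.integral_const_mul, ← sub_zero (∫ t in (0 : ℝ)..X, -freq X j * _), ← h0,
      ← intervalIntegral.integral_sub (hEu.const_mul _) (hc0.intervalIntegrable 0 X)]
    refine intervalIntegral.integral_congr fun t ht => ?_
    rw [uIcc_of_le hX.le] at ht
    rw [show ∫ s in (0 : ℝ)..t, (u s + g s) = u t - u 0 by rw [hode t ht]; ring]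
    ring
  rw [hleft, hend, mul_zero, zero_sub, hsplit] at hparts
  rw [eq_inv_mul_iff_mul_eq₀ (freq_sub_one_ne_zero X j)]
  linear_combination -hparts

/-- The Fourier coefficient `(1/X) ∫₀^X f(x) e ^ (-2πimx/X) dx` of a scalar function. -/
noncomputable def fourierEntry (X : ℝ) (f : ℝ → ℂ) (m : ℤ) : ℂ :=
  (X : ℂ)⁻¹ * ∫ x in (0 : ℝ)..X, f x * Complex.exp (-(2 * Real.pi * Complex.I * m * x / X))

theorem fourierEntry_eq (X : ℝ) (f : ℝ → ℂ) (m : ℤ) : fourierEntry X f m =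
    (X : ℂ)⁻¹ * ∫ x in (0 : ℝ)..X, Complex.exp (-freq X m * x) * f x := by
  unfold fourierEntry
  congr 2
  ext x
  rw [mul_comm]
  congr 2
  unfold freq
  ring

theorem continuous_mode {ι : Type} [DecidableEq ι] (X : ℝ) (p : ℤ × ι) : Continuous fun x : ℝ =>
    (EuclideanSpace.single p.2 (((√X)⁻¹ : ℝ) * Complex.exp (freq X p.1 * x)) :
      EuclideanSpace ℂ ι) := by
  refine (PiLp.continuous_toLp 2 _).comp (continuous_pi fun b => ?_)
  by_cases h : b = p.2
  · subst h; simp only [Pi.single_eq_same]; fun_prop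
  · simp only [Pi.single_eq_of_ne h]; fun_prop

variable {X : ℝ} {ι : Type} [Fintype ι] [DecidableEq ι]

/-- The normalized Fourier mode with frequency `j` in the coordinate direction `a`. -/
noncomputable def mode (X : ℝ) (p : ℤ × ι) : L2Space X ι :=
  (memLp_of_continuousOn (continuous_mode X p).continuousOn).toLp _

theorem coeFn_mode (p : ℤ × ι) : mode X p =ᵐ[volume.restrict (Ioc 0 X)] fun x : ℝ =>
    (EuclideanSpace.single p.2 (((√X)⁻¹ : ℝ) * Complex.exp (freq X p.1 * x)) :
      EuclideanSpace ℂ ι) :=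
  MemLp.coeFn_toLp (memLp_of_continuousOn (continuous_mode X p).continuousOn)

theorem inner_mode (hX : 0 < X) (p : ℤ × ι) {f : L2Space X ι} {u : ℝ → EuclideanSpace ℂ ι}
    (hf : f =ᵐ[volume.restrict (Ioc 0 X)] u) : inner ℂ (mode X p) f =
      ((√X)⁻¹ : ℝ) * ∫ x in (0 : ℝ)..X, Complex.exp (-freq X p.1 * x) * u x p.2 := by
  rw [L2.inner_def, intervalIntegral.integral_of_le hX.le, ← integral_const_mul]
  refine integral_congr_ae ?_
  filter_upwards [coeFn_mode (X := X) p, hf] with x h1 h2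
  rw [h1, h2, EuclideanSpace.inner_single_left, map_mul, conj_exp_freq_mul, Complex.conj_ofReal,
    mul_assoc]

theorem sqrt_inv_mul_self (hX : 0 < X) :
    (((√X)⁻¹ : ℝ) : ℂ) * ((√X)⁻¹ : ℝ) = (X : ℂ)⁻¹ := by
  rw [← Complex.ofReal_mul, ← mul_inv, Real.mul_self_sqrt hX.le, Complex.ofReal_inv]

theorem exp_neg_freq_mul_exp_freq (X : ℝ) (j k : ℤ) (x : ℝ) :
    Complex.exp (-freq X j * x) * Complex.exp (freq X k * x) =
      Complex.exp (-freq X (j - k) * x) := by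
  rw [← Complex.exp_add, freq_sub]
  congr 1
  ring

theorem orthonormal_mode (hX : 0 < X) : Orthonormal ℂ (mode X : ℤ × ι → L2Space X ι) := by
  rw [orthonormal_iff_ite]
  intro p q
  rw [inner_mode hX p (coeFn_mode q)]
  have hXc : (X : ℂ) ≠ 0 := by exact_mod_cast hX.ne'
  by_cases h2 : p.2 = q.2
  · have h3 : ∀ x : ℝ, Complex.exp (-freq X p.1 * x) * (EuclideanSpace.single q.2
        (((√X)⁻¹ : ℝ) * Complex.exp (freq X q.1 * x)) : EuclideanSpace ℂ ι) p.2 =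
        ((√X)⁻¹ : ℝ) * Complex.exp (-freq X (p.1 - q.1) * x) := fun x => by
      rw [PiLp.single_apply, if_pos h2, ← exp_neg_freq_mul_exp_freq]
      ring
    simp only [h3]
    rw [intervalIntegral.integral_const_mul, integral_exp_neg_freq hX, ← mul_assoc,
      sqrt_inv_mul_self hX]
    by_cases h1 : p.1 = q.1
    · rw [if_pos (sub_eq_zero.2 h1), if_pos (Prod.ext h1 h2), inv_mul_cancel₀ hXc]
    · rw [if_neg (sub_ne_zero.2 h1), if_neg (fun h => h1 (congrArg Prod.fst h)), mul_zero]
  · have h3 : ∀ x : ℝ, Complex.exp (-freq X p.1 * x) * (EuclideanSpace.single q.2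
        (((√X)⁻¹ : ℝ) * Complex.exp (freq X q.1 * x)) : EuclideanSpace ℂ ι) p.2 = 0 := fun x => by
      rw [PiLp.single_apply, if_neg h2, mul_zero]
    simp only [h3]
    rw [if_neg (fun h => h2 (congrArg Prod.snd h))]
    simp

/-- The modes with wave number at most `J`. -/
noncomputable def lowMode (X : ℝ) (J : ℕ) (p : Finset.Icc (-(J : ℤ)) J × ι) : L2Space X ι :=
  mode X ((p.1 : ℤ), p.2)

theorem orthonormal_lowMode (hX : 0 < X) (J : ℕ) :
    Orthonormal ℂ (lowMode X J : Finset.Icc (-(J : ℤ)) J × ι → L2Space X ι) := by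
  refine (orthonormal_mode hX).comp (fun p : Finset.Icc (-(J : ℤ)) J × ι => ((p.1 : ℤ), p.2)) ?_
  rintro ⟨p, a⟩ ⟨q, b⟩ h
  simp only [Prod.mk.injEq] at h
  exact Prod.ext (Subtype.ext h.1) h.2

/-- The trigonometric polynomials of degree at most `J`. -/
noncomputable def lowModes (X : ℝ) (ι : Type) [Fintype ι] [DecidableEq ι] (J : ℕ) :
    Submodule ℂ (L2Space X ι) :=
  Submodule.span ℂ (Set.range (lowMode X J))

instance (J : ℕ) : FiniteDimensional ℂ (lowModes X ι J) :=
  FiniteDimensional.span_of_finite ℂ (Set.finite_range _)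

theorem monotone_lowModes : Monotone (lowModes X ι) := by
  intro J J' h
  refine Submodule.span_mono ?_
  rintro _ ⟨⟨⟨j, hj⟩, a⟩, rfl⟩
  have h' : (J : ℤ) ≤ J' := by exact_mod_cast h
  rw [Finset.mem_Icc] at hj
  exact ⟨⟨⟨j, Finset.mem_Icc.2 ⟨by omega, by omega⟩⟩, a⟩, rfl⟩

/-- Completeness of the Fourier modes, from Parseval's identity in each coordinate. -/
theorem eq_zero_of_inner_mode_eq_zero (hX : 0 < X) {f : L2Space X ι}
    (hf : ∀ p, inner ℂ (mode X p) f = 0) : f = 0 := by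
  have hmem : ∀ a, MemLp (fun x => f x a) 2 (volume.restrict (Ioc 0 X)) := fun a =>
    (Lp.memLp f).eval_piLp a
  have hzero : ∀ a, ∫ x in (0 : ℝ)..X, ‖f x a‖ ^ 2 = 0 := fun a => by
    have hsum := hasSum_sq_fourierCoeffOn hX (hmem a)
    have hcoef : ∀ j, fourierCoeffOn hX (fun x => f x a) j = 0 := fun j => by
      have h1 := hf (j, a)
      rw [inner_mode hX _ (EventuallyEq.refl _ _)] at h1
      have hs : (((√X)⁻¹ : ℝ) : ℂ) ≠ 0 := by
        have := (Real.sqrt_pos.2 hX).ne'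
        exact_mod_cast inv_ne_zero this
      have h2 := (mul_eq_zero.1 h1).resolve_left hs
      rw [fourierCoeffOn_eq_integral]
      have h3 : ∫ x in (0 : ℝ)..X, fourier (-j) (x : AddCircle (X - 0)) • f x a =
          ∫ x in (0 : ℝ)..X, Complex.exp (-freq X j * x) * f x a := by
        refine intervalIntegral.integral_congr fun x _ => ?_
        simp only [fourier_coe_apply, smul_eq_mul]
        congr 2
        unfold freq
        push_cast
        rw [sub_zero]
        ring
      rw [h3, h2, smul_zero]
    simp only [hcoef, norm_zero, ne_eq, OfNat.ofNat_ne_zero, not_false_eq_true, zero_pow,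
      sub_zero] at hsum
    have := hsum.unique hasSum_zero
    exact (smul_eq_zero.1 this).resolve_left (inv_ne_zero hX.ne')
  have hnorm : ‖f‖ ^ 2 = 0 := by
    rw [norm_sq_eq_integral]
    simp only [EuclideanSpace.norm_sq_eq]
    rw [integral_finsetSum _ fun a _ => (hmem a).integrable_norm_pow two_ne_zero]
    refine Finset.sum_eq_zero fun a _ => ?_
    rw [← intervalIntegral.integral_of_le hX.le, hzero a]
  exact norm_eq_zero.1 (pow_eq_zero_iff two_ne_zero |>.1 hnorm)

theorem dense_iUnion_lowModes (hX : 0 < X) : Dense (⋃ J, (lowModes X ι J : Set (L2Space X ι))) := by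
  have hset : (⋃ J, (lowModes X ι J : Set (L2Space X ι))) =
      ((⨆ J, lowModes X ι J : Submodule ℂ (L2Space X ι)) : Set (L2Space X ι)) :=
    (Submodule.coe_iSup_of_directed _ monotone_lowModes.directed_le).symm
  rw [hset, Submodule.dense_iff_topologicalClosure_eq_top, Submodule.topologicalClosure_eq_top_iff,
    Submodule.eq_bot_iff]
  intro f hf
  refine eq_zero_of_inner_mode_eq_zero hX fun p => ?_
  refine (Submodule.mem_orthogonal _ _).1 hf _ ?_
  refine Submodule.mem_iSup_of_mem p.1.natAbs (Submodule.subset_span ?_)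
  exact ⟨⟨⟨p.1, Finset.mem_Icc.2 ⟨by omega, by omega⟩⟩, p.2⟩, rfl⟩

/-- The Galerkin 2-modified determinant on the span of an orthonormal family, as a matrix
determinant. -/
theorem finiteDet₂_galerkin_span {H κ : Type*} [NormedAddCommGroup H] [InnerProductSpace ℂ H]
    [Fintype κ] [DecidableEq κ] (K : H →L[ℂ] H) {v : κ → H} (hv : Orthonormal ℂ v)
    [FiniteDimensional ℂ (Submodule.span ℂ (Set.range v))] {B : Matrix κ κ ℂ}
    (hB : ∀ i j, inner ℂ (v i) (K (v j)) = B i j) :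
    finiteDet₂ (galerkin K (Submodule.span ℂ (Set.range v))) =
      (1 - B).det * Complex.exp B.trace := by
  let b := Module.Basis.span hv.linearIndependent
  have hb : ∀ i, ((b i : Submodule.span ℂ (Set.range v)) : H) = v i := fun i =>
    congrArg Subtype.val (Module.Basis.span_apply hv.linearIndependent i)
  have hbo : Orthonormal ℂ b := by
    rw [orthonormal_iff_ite]
    intro i j
    rw [Submodule.coe_inner, hb, hb, orthonormal_iff_ite.1 hv i j]
  let o := b.toOrthonormalBasis hbo
  have ho : ∀ i, ((o i : Submodule.span ℂ (Set.range v)) : H) = v i := fun i => by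
    rw [show o i = b i from congrFun (b.coe_toOrthonormalBasis hbo) i, hb]
  have hmat : LinearMap.toMatrix o.toBasis o.toBasis
      (galerkin K (Submodule.span ℂ (Set.range v))) = B := by
    ext i j
    rw [LinearMap.toMatrix_apply, OrthonormalBasis.coe_toBasis_repr_apply,
      OrthonormalBasis.repr_apply_apply, OrthonormalBasis.coe_toBasis, ← hB, ← ho i, ← ho j]
    exact Submodule.inner_orthogonalProjectionOnto_eq_of_mem_left _ _
  rw [finiteDet₂, ← LinearMap.det_toMatrix o.toBasis, map_sub, LinearMap.toMatrix_one, hmat,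
    LinearMap.trace_eq_matrix_trace ℂ o.toBasis, hmat]

/-- The truncated Fourier matrix of `(∂ₓ - 1)⁻¹ (M - 1)`. -/
noncomputable def fourierTruncation (X : ℝ) (M : ℝ → Matrix ι ι ℂ) (J : ℕ) :
    Matrix (Finset.Icc (-(J : ℤ)) J × ι) (Finset.Icc (-(J : ℤ)) J × ι) ℂ :=
  Matrix.of fun p q => (freq X p.1 - 1)⁻¹ *
    (fourierEntry X (fun x => M x p.2 q.2) ((p.1 : ℤ) - (q.1 : ℤ)) - if p = q then 1 else 0)

/-- The matrix of `(∂ₓ - 1)⁻¹ (M - 1)` in the basis of Fourier modes. -/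
theorem IsBirmanSchwinger.inner_mode_apply (hX : 0 < X) {M : ℝ → Matrix ι ι ℂ} (hM : MemL2 X M)
    {K : L2Space X ι →L[ℂ] L2Space X ι} (hK : IsBirmanSchwinger X M K) (p q : ℤ × ι) :
    inner ℂ (mode X p) (K (mode X q)) = (freq X p.1 - 1)⁻¹ *
      (fourierEntry X (fun x => M x p.2 q.2) (p.1 - q.1) - if p = q then 1 else 0) := by
  obtain ⟨u, ⟨huc, hper, hode⟩, hKu⟩ := hK (mode X q)
  rw [inner_mode hX p hKu, integral_exp_neg_freq_mul_of_ode hX p.1 (u := fun x => u x p.2)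
    ((PiLp.continuous_apply 2 _ p.2).comp_continuousOn huc)
    (hM.intervalIntegrable_mulVec hX.le p.2 (mode X q)) (by rw [hper])
    (fun x hx => hode x hx p.2), mul_left_comm]
  congr 1
  have hMi : IntervalIntegrable (fun x => M x p.2 q.2) volume 0 X := by
    rw [intervalIntegrable_iff_integrableOn_Ioc_of_le hX.le]
    exact (hM p.2 q.2).integrable one_le_two
  have hexp : Continuous fun x : ℝ => Complex.exp (-freq X (p.1 - q.1) * (x : ℂ)) := by fun_prop
  have hEM : IntervalIntegrable (fun x : ℝ => Complex.exp (-freq X (p.1 - q.1) * x) *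
      M x p.2 q.2) volume 0 X := hMi.continuousOn_mul hexp.continuousOn
  have hint : ∫ x in (0 : ℝ)..X, Complex.exp (-freq X p.1 * x) *
        ((M x - 1) *ᵥ (mode X q x).ofLp) p.2 =
      ((√X)⁻¹ : ℝ) * ((∫ x in (0 : ℝ)..X, Complex.exp (-freq X (p.1 - q.1) * x) * M x p.2 q.2) -
        (1 : Matrix ι ι ℂ) p.2 q.2 * ∫ x in (0 : ℝ)..X, Complex.exp (-freq X (p.1 - q.1) * x)) := by
    rw [← intervalIntegral.integral_const_mul,
      ← intervalIntegral.integral_sub hEM ((hexp.intervalIntegrable 0 X).const_mul _),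
      ← intervalIntegral.integral_const_mul, intervalIntegral.integral_of_le hX.le,
      intervalIntegral.integral_of_le hX.le]
    refine integral_congr_ae ?_
    filter_upwards [coeFn_mode (X := X) q] with x hx
    rw [hx, PiLp.ofLp_single, Matrix.mulVec_single, ← exp_neg_freq_mul_exp_freq]
    simp only [Pi.smul_apply, Matrix.col_apply, Matrix.sub_apply,
      MulOpposite.smul_eq_mul_unop, MulOpposite.unop_op]
    ring
  have hXc : (X : ℂ) ≠ 0 := by exact_mod_cast hX.ne'
  rw [hint, ← mul_assoc, sqrt_inv_mul_self hX, fourierEntry_eq, mul_sub,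
    integral_exp_neg_freq hX]
  congr 1
  by_cases h2 : p.2 = q.2
  · rw [h2, Matrix.one_apply_eq, one_mul]
    by_cases h1 : p.1 = q.1
    · rw [if_pos (sub_eq_zero.2 h1), if_pos (Prod.ext h1 h2), inv_mul_cancel₀ hXc]
    · rw [if_neg (sub_ne_zero.2 h1), if_neg (fun h => h1 (congrArg Prod.fst h)), mul_zero]
  · rw [Matrix.one_apply_ne h2, if_neg (fun h => h2 (congrArg Prod.snd h)), zero_mul, mul_zero]

theorem HasDet₂.tendsto_fourierTruncation (hX : 0 < X) {M : ℝ → Matrix ι ι ℂ} (hM : MemL2 X M)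
    {K : L2Space X ι →L[ℂ] L2Space X ι} (hK : IsBirmanSchwinger X M K) {d : ℂ}
    (hd : HasDet₂ K d) :
    Tendsto (fun J => (1 - fourierTruncation X M J).det *
      Complex.exp (fourierTruncation X M J).trace) atTop (𝓝 d) := by
  refine (hd (lowModes X ι) monotone_lowModes (dense_iUnion_lowModes hX)).congr fun J => ?_
  have : FiniteDimensional ℂ (Submodule.span ℂ (Set.range (lowMode (ι := ι) X J))) :=
    inferInstanceAs (FiniteDimensional ℂ (lowModes X ι J))
  refine finiteDet₂_galerkin_span K (orthonormal_lowMode hX J) fun p q => ?_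
  rw [lowMode, lowMode, hK.inner_mode_apply hX hM, fourierTruncation, Matrix.of_apply]
  congr 2
  simp only [Prod.ext_iff, Subtype.ext_iff]

end Fourier

/-! ### Similarity of the truncated systems -/

section Truncation

variable {X : ℝ} {n : ℕ} {A₀ A₁ D₁ B₀ : ℝ → Matrix (Fin n) (Fin n) ℂ}

theorem MemL2.fromBlocks {A B C D : ℝ → Matrix (Fin n) (Fin n) ℂ} (hA : MemL2 X A)
    (hB : MemL2 X B) (hC : MemL2 X C) (hD : MemL2 X D) :
    MemL2 X fun x => Matrix.fromBlocks (A x) (B x) (C x) (D x) := by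
  rintro (i | i) (j | j)
  exacts [hA i j, hB i j, hC i j, hD i j]

theorem MemL2.systemMatrix (hA₀ : MemL2 X A₀) (hA₁ : MemL2 X A₁) (hD₁ : MemL2 X D₁)
    (hB₀ : MemL2 X B₀) (lam : ℂ) : MemL2 X (systemMatrix A₀ A₁ D₁ B₀ lam) :=
  MemL2.fromBlocks (fun _ _ => memLp_const _) (fun _ _ => memLp_const _)
    (fun i j => (((hB₀ i j).const_mul lam).sub (hA₀ i j)).sub (hD₁ i j)) (fun i j => (hA₁ i j).neg)

theorem MemL2.quasiMatrix (hA₀ : MemL2 X A₀) (hA₁ : MemL2 X A₁) (hB₀ : MemL2 X B₀) (lam : ℂ) :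
    MemL2 X (quasiMatrix A₀ A₁ B₀ lam) :=
  MemL2.fromBlocks (fun i j => (hA₁ i j).neg) (fun _ _ => memLp_const _)
    (fun i j => ((hB₀ i j).const_mul lam).sub (hA₀ i j)) (fun _ _ => memLp_const _)

theorem MemL2.intervalIntegrable (hX : 0 ≤ X) (hA : MemL2 X A₁) (i j : Fin n) :
    IntervalIntegrable (fun x => A₁ x i j) volume 0 X := by
  rw [intervalIntegrable_iff_integrableOn_Ioc_of_le hX]
  exact (hA i j).integrable one_le_two

/-- Both first-order systems have trace `-tr A₁`. -/
theorem gammaFactor_eq_of_trace (hX : 0 < X) (hA₁ : MemL2 X A₁)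
    {M : ℝ → Matrix (Fin n ⊕ Fin n) (Fin n ⊕ Fin n) ℂ} (hM : ∀ x, (M x).trace = -(A₁ x).trace) :
    gammaFactor X M = Complex.exp (Complex.exp X / (Complex.exp X - 1) *
      ((meanMatrix X A₁).trace + 2 * n) * X) := by
  have hXc : (X : ℂ) ≠ 0 := by exact_mod_cast hX.ne'
  have h1 : (1 : ℂ) - Complex.exp X ≠ 0 := by
    rw [← neg_ne_zero, neg_sub]; exact exp_sub_one_ne_zero hX
  have h2 := exp_sub_one_ne_zero hX
  have htr : (meanMatrix X A₁).trace * X = ∫ y in (0 : ℝ)..X, (A₁ y).trace := by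
    simp only [Matrix.trace, Matrix.diag_apply, meanMatrix, Matrix.of_apply]
    rw [intervalIntegral.integral_finsetSum fun i _ => hA₁.intervalIntegrable hX.le i i,
      Finset.sum_mul]
    exact Finset.sum_congr rfl fun i _ => by field_simp
  have htrint : IntervalIntegrable (fun y => (A₁ y).trace) volume 0 X := by
    have := IntervalIntegrable.sum (μ := volume) (a := 0) (b := X) Finset.univ
      (f := fun (i : Fin n) y => A₁ y i i) fun i _ => hA₁.intervalIntegrable hX.le i i
    exact this.congr (fun y _ => by simp [Matrix.trace])
  have hint : ∫ y in (0 : ℝ)..X, ((M y).trace - (Fintype.card (Fin n ⊕ Fin n) : ℂ)) =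
      -((meanMatrix X A₁).trace * X) - 2 * n * X := by
    simp only [hM, Fintype.card_sum, Fintype.card_fin, Nat.cast_add]
    have hneg : IntervalIntegrable (fun y => -(A₁ y).trace) volume 0 X := htrint.neg
    rw [intervalIntegral.integral_sub hneg intervalIntegrable_const,
      intervalIntegral.integral_neg, ← htr, intervalIntegral.integral_const]
    simp only [sub_zero, Complex.real_smul]
    ring
  rw [gammaFactor, hint]
  congr 1
  field_simp
  ring

/-- Truncated multiplication by a matrix function with Fourier coefficients `F`. -/
def toeplitz {m : Type*} (J : ℕ) (F : ℤ → Matrix m m ℂ) :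
    Matrix (Finset.Icc (-(J : ℤ)) J × m) (Finset.Icc (-(J : ℤ)) J × m) ℂ :=
  Matrix.of fun p q => F ((p.1 : ℤ) - (q.1 : ℤ)) p.2 q.2

/-- Truncated differentiation. -/
noncomputable def derivMatrix (X : ℝ) (J : ℕ) (m : Type*) [DecidableEq m] :
    Matrix (Finset.Icc (-(J : ℤ)) J × m) (Finset.Icc (-(J : ℤ)) J × m) ℂ :=
  Matrix.diagonal fun p => freq X p.1

/-- The truncated Birman-Schwinger matrix of a coefficient with Fourier coefficients `F`. -/
noncomputable def toeplitzBS {m : Type*} [DecidableEq m] (X : ℝ) (J : ℕ) (F : ℤ → Matrix m m ℂ) :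
    Matrix (Finset.Icc (-(J : ℤ)) J × m) (Finset.Icc (-(J : ℤ)) J × m) ℂ :=
  Matrix.of fun p q => (freq X p.1 - 1)⁻¹ *
    (F ((p.1 : ℤ) - (q.1 : ℤ)) p.2 q.2 - if p = q then 1 else 0)

theorem det_one_sub_toeplitzBS {m : Type*} [Fintype m] [DecidableEq m] (X : ℝ) (J : ℕ)
    (F : ℤ → Matrix m m ℂ) : (1 - toeplitzBS X J F).det =
      (∏ p : Finset.Icc (-(J : ℤ)) J × m, (freq X p.1 - 1)⁻¹) *
        (derivMatrix X J m - toeplitz J F).det := by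
  rw [← Matrix.det_diagonal, ← Matrix.det_mul]
  congr 1
  ext p q
  rw [Matrix.diagonal_mul]
  simp only [Matrix.sub_apply, toeplitzBS, toeplitz, derivMatrix, Matrix.of_apply, Matrix.one_apply,
    Matrix.diagonal_apply]
  have := freq_sub_one_ne_zero X p.1
  split_ifs <;> field_simp <;> ring

/-- The Fourier coefficients of `quasiMatrix`. -/
noncomputable def quasiFourier (X : ℝ) (A₀ A₁ B₀ : ℝ → Matrix (Fin n) (Fin n) ℂ) (lam : ℂ)
    (m : ℤ) : Matrix (Fin n ⊕ Fin n) (Fin n ⊕ Fin n) ℂ :=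
  Matrix.fromBlocks (-fourierMatrix X A₁ m) (if m = 0 then 1 else 0)
    (lam • fourierMatrix X B₀ m - fourierMatrix X A₀ m) 0

theorem fourierTruncation_quasiMatrix (hX : 0 < X) (hA₀ : MemL2 X A₀) (hB₀ : MemL2 X B₀)
    (lam : ℂ) (J : ℕ) : fourierTruncation X (quasiMatrix A₀ A₁ B₀ lam) J =
      toeplitzBS X J (quasiFourier X A₀ A₁ B₀ lam) := by
  have hXc : (X : ℂ) ≠ 0 := by exact_mod_cast hX.ne'
  have key : ∀ (m : ℤ) (a b : Fin n ⊕ Fin n),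
      fourierEntry X (fun x => quasiMatrix A₀ A₁ B₀ lam x a b) m =
        quasiFourier X A₀ A₁ B₀ lam m a b := by
    rintro m (i | i) (j | j)
    · simp [quasiMatrix, quasiFourier, fourierEntry, fourierMatrix]
    · simp only [quasiMatrix, quasiFourier, Matrix.fromBlocks_apply₁₂]
      rw [fourierEntry_eq, intervalIntegral.integral_mul_const, integral_exp_neg_freq hX]
      split_ifs <;> simp [hXc]
    · have hexp : Continuous fun x : ℝ =>
          Complex.exp (-(2 * Real.pi * Complex.I * m * x / X)) := by fun_prop
      have h1 := (hB₀.intervalIntegrable hX.le i j).mul_continuousOn hexp.continuousOn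
      have h2 := (hA₀.intervalIntegrable hX.le i j).mul_continuousOn hexp.continuousOn
      simp only [quasiMatrix, quasiFourier, fourierEntry, fourierMatrix,
        Matrix.fromBlocks_apply₂₁, Matrix.sub_apply, Matrix.smul_apply, smul_eq_mul,
        Matrix.of_apply]
      have h3 : ∀ x : ℝ, (lam * B₀ x i j - A₀ x i j) *
          Complex.exp (-(2 * Real.pi * Complex.I * m * x / X)) =
          lam * (B₀ x i j * Complex.exp (-(2 * Real.pi * Complex.I * m * x / X))) -
            A₀ x i j * Complex.exp (-(2 * Real.pi * Complex.I * m * x / X)) := fun x => by ring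
      simp only [h3]
      rw [intervalIntegral.integral_sub (h1.const_mul lam) h2,
        intervalIntegral.integral_const_mul]
      ring
    · simp [quasiMatrix, quasiFourier, fourierEntry]
  ext p q
  simp only [fourierTruncation, toeplitzBS, Matrix.of_apply, key]

/-- The truncated operators `∂ₓ - 𝒜` and `∂ₓ - 𝒜^q` are conjugate under the unipotent change of
variables `(U, Uₓ + A₁ U) ↦ (U, Uₓ)` with truncated `A₁`: the truncation of `∂ₓ A₁` is exactly the
commutator of the truncated derivative and the truncated `A₁`. -/
theorem det_derivMatrix_sub_toeplitz (X : ℝ) (A₀ A₁ B₀ : ℝ → Matrix (Fin n) (Fin n) ℂ) (lam : ℂ)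
    (J : ℕ) : (derivMatrix X J (Fin n ⊕ Fin n) - toeplitz J (systemFourier X A₀ A₁ B₀ lam)).det =
      (derivMatrix X J (Fin n ⊕ Fin n) - toeplitz J (quasiFourier X A₀ A₁ B₀ lam)).det := by
  set d := derivMatrix X J (Fin n) with hd
  set a := toeplitz J (fourierMatrix X A₁) with ha
  set c := toeplitz J (fun m => lam • fourierMatrix X B₀ m - fourierMatrix X A₀ m) with hc
  let e := Equiv.prodSumDistrib (Finset.Icc (-(J : ℤ)) J) (Fin n) (Fin n)
  have hone : ∀ (p q : Finset.Icc (-(J : ℤ)) J) (i j : Fin n),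
      (if (p : ℤ) - (q : ℤ) = 0 then (1 : Matrix (Fin n) (Fin n) ℂ) else 0) i j =
        (1 : Matrix (Finset.Icc (-(J : ℤ)) J × Fin n) (Finset.Icc (-(J : ℤ)) J × Fin n) ℂ)
          (p, i) (q, j) := by
    intro p q i j
    by_cases h : p = q
    · subst h; simp [Matrix.one_apply]
    · have h' : (p : ℤ) - (q : ℤ) ≠ 0 := sub_ne_zero.2 fun h' => h (Subtype.ext h')
      simp [h, h']
  have hs : (derivMatrix X J (Fin n ⊕ Fin n) -
      toeplitz J (systemFourier X A₀ A₁ B₀ lam)).reindex e e =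
      Matrix.fromBlocks d (-1) (-(c - (d * a - a * d))) (d + a) := by
    ext (⟨p, i⟩ | ⟨p, i⟩) (⟨q, j⟩ | ⟨q, j⟩)
    · simp [e, hd, derivMatrix, toeplitz, systemFourier, Matrix.diagonal_apply]
    · simp [e, derivMatrix, toeplitz, systemFourier, hone]
    · simp only [e, hd, ha, hc, derivMatrix, toeplitz, systemFourier, Matrix.reindex_apply,
        Matrix.submatrix_apply, Equiv.prodSumDistrib_symm_apply_left,
        Equiv.prodSumDistrib_symm_apply_right, Matrix.sub_apply, Matrix.of_apply,
        Matrix.diagonal_apply, Matrix.fromBlocks_apply₂₁, Matrix.neg_apply, Matrix.diagonal_mul,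
        Matrix.mul_diagonal, Matrix.smul_apply, smul_eq_mul]
      rw [if_neg (by simp)]
      have := freq_sub X p q
      rw [freq] at this
      rw [this]
      ring
    · simp [e, hd, ha, derivMatrix, toeplitz, systemFourier, Matrix.diagonal_apply]
  have hq : (derivMatrix X J (Fin n ⊕ Fin n) -
      toeplitz J (quasiFourier X A₀ A₁ B₀ lam)).reindex e e =
      Matrix.fromBlocks (d + a) (-1) (-c) d := by
    ext (⟨p, i⟩ | ⟨p, i⟩) (⟨q, j⟩ | ⟨q, j⟩)
    · simp [e, hd, ha, derivMatrix, toeplitz, quasiFourier, Matrix.diagonal_apply]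
    · simp [e, derivMatrix, toeplitz, quasiFourier, hone]
    · simp [e, hc, derivMatrix, toeplitz, quasiFourier]
    · simp [e, hd, derivMatrix, toeplitz, quasiFourier, Matrix.diagonal_apply]
  rw [← Matrix.det_reindex_self e, ← Matrix.det_reindex_self e
    (derivMatrix X J (Fin n ⊕ Fin n) - toeplitz J (quasiFourier X A₀ A₁ B₀ lam)), hs, hq]
  have hconj : Matrix.fromBlocks (d + a) (-1) (-c) d =
      Matrix.fromBlocks 1 0 a 1 * Matrix.fromBlocks d (-1) (-(c - (d * a - a * d))) (d + a) *
        Matrix.fromBlocks 1 0 (-a) 1 := by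
    rw [Matrix.fromBlocks_multiply, Matrix.fromBlocks_multiply]
    congr 1 <;> noncomm_ring
  rw [hconj, Matrix.det_mul, Matrix.det_mul, Matrix.det_fromBlocks_zero₁₂,
    Matrix.det_fromBlocks_zero₁₂]
  simp

theorem trace_toeplitzBS_systemFourier (X : ℝ) (A₀ A₁ B₀ : ℝ → Matrix (Fin n) (Fin n) ℂ) (lam : ℂ)
    (J : ℕ) : (toeplitzBS X J (systemFourier X A₀ A₁ B₀ lam)).trace =
      (toeplitzBS X J (quasiFourier X A₀ A₁ B₀ lam)).trace := by
  simp only [Matrix.trace, Matrix.diag_apply, toeplitzBS, Matrix.of_apply, sub_self, if_true]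
  rw [Fintype.sum_prod_type, Fintype.sum_prod_type]
  refine Finset.sum_congr rfl fun p _ => ?_
  rw [Fintype.sum_sum_type, Fintype.sum_sum_type, add_comm]
  simp [systemFourier, quasiFourier]

/-- `F_J` only sees the coefficient matrix of the system for `(U, Uₓ + A₁ U)`. -/
theorem truncatedF_eq (hX : 0 < X) (hA₀ : MemL2 X A₀) (hB₀ : MemL2 X B₀) (lam : ℂ) (J : ℕ) :
    truncatedF X A₀ A₁ B₀ lam J =
      (1 - fourierTruncation X (quasiMatrix A₀ A₁ B₀ lam) J).det *
        Complex.exp (fourierTruncation X (quasiMatrix A₀ A₁ B₀ lam) J).trace := by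
  have hbs : truncatedBS X A₀ A₁ B₀ lam J = toeplitzBS X J (systemFourier X A₀ A₁ B₀ lam) := rfl
  rw [truncatedF, hbs, fourierTruncation_quasiMatrix hX hA₀ hB₀, det_one_sub_toeplitzBS,
    det_one_sub_toeplitzBS, det_derivMatrix_sub_toeplitz, trace_toeplitzBS_systemFourier]

end Truncation

end PeriodicEvans

theorem theorem5p1 (X : ℝ) (hX : 0 < X) (n : ℕ)
    (A₀ A₁ B₀ : ℝ → Matrix (Fin n) (Fin n) ℂ)
    (hpA₀ : Function.Periodic A₀ X) (hpA₁ : Function.Periodic A₁ X)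
    (hpB₀ : Function.Periodic B₀ X)
    (hA₀ : PeriodicEvans.MemL2 X A₀) (hA₁ : PeriodicEvans.MemL2 X A₁)
    (hB₀ : PeriodicEvans.MemL2 X B₀) (lam : ℂ) :
    -- the system for `(U, Uₓ)`, whenever its coefficient matrix is square integrable
    (∀ D₁ : ℝ → Matrix (Fin n) (Fin n) ℂ, Function.Periodic D₁ X → PeriodicEvans.MemL2 X D₁ →
      PeriodicEvans.IsPeriodicWeakDeriv X A₁ D₁ →
      (∃! K, PeriodicEvans.IsBirmanSchwinger X
        (PeriodicEvans.systemMatrix A₀ A₁ D₁ B₀ lam) K) ∧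
      (∃ Ψ, PeriodicEvans.IsFundamentalSolution X
        (PeriodicEvans.systemMatrix A₀ A₁ D₁ B₀ lam) Ψ) ∧
      (∀ K Ψ,
        PeriodicEvans.IsBirmanSchwinger X (PeriodicEvans.systemMatrix A₀ A₁ D₁ B₀ lam) K →
        PeriodicEvans.IsFundamentalSolution X (PeriodicEvans.systemMatrix A₀ A₁ D₁ B₀ lam) Ψ →
        PeriodicEvans.IsHilbertSchmidt K ∧
        PeriodicEvans.HasDet₂ K
          (PeriodicEvans.gammaFactor X (PeriodicEvans.systemMatrix A₀ A₁ D₁ B₀ lam) *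
            (Complex.exp X - 1) ^ (-(2 * n : ℤ)) * (Ψ X - 1).det)) ∧
      PeriodicEvans.gammaFactor X (PeriodicEvans.systemMatrix A₀ A₁ D₁ B₀ lam) =
        Complex.exp (Complex.exp X / (Complex.exp X - 1) *
          ((PeriodicEvans.meanMatrix X A₁).trace + 2 * n) * X)) ∧
    -- arbitrary square integrable coefficients, through the system for `(U, Uₓ + A₁ U)`
    ((∃! K, PeriodicEvans.IsBirmanSchwinger X (PeriodicEvans.quasiMatrix A₀ A₁ B₀ lam) K) ∧
      (∃ Ψ, PeriodicEvans.IsFundamentalSolution X (PeriodicEvans.quasiMatrix A₀ A₁ B₀ lam) Ψ) ∧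
      (∀ K Ψ,
        PeriodicEvans.IsBirmanSchwinger X (PeriodicEvans.quasiMatrix A₀ A₁ B₀ lam) K →
        PeriodicEvans.IsFundamentalSolution X (PeriodicEvans.quasiMatrix A₀ A₁ B₀ lam) Ψ →
        PeriodicEvans.IsHilbertSchmidt K ∧
        PeriodicEvans.HasDet₂ K
          (PeriodicEvans.gammaFactor X (PeriodicEvans.quasiMatrix A₀ A₁ B₀ lam) *
            (Complex.exp X - 1) ^ (-(2 * n : ℤ)) * (Ψ X - 1).det) ∧
        Filter.Tendsto (PeriodicEvans.truncatedF X A₀ A₁ B₀ lam) Filter.atTop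
          (nhds (PeriodicEvans.gammaFactor X (PeriodicEvans.quasiMatrix A₀ A₁ B₀ lam) *
            (Complex.exp X - 1) ^ (-(2 * n : ℤ)) * (Ψ X - 1).det))) ∧
      PeriodicEvans.gammaFactor X (PeriodicEvans.quasiMatrix A₀ A₁ B₀ lam) =
        Complex.exp (Complex.exp X / (Complex.exp X - 1) *
          ((PeriodicEvans.meanMatrix X A₁).trace + 2 * n) * X)) := by
  have hexp : (-(Fintype.card (Fin n ⊕ Fin n) : ℤ)) = -(2 * n : ℤ) := by
    simp only [Fintype.card_sum, Fintype.card_fin, Nat.cast_add]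
    ring
  refine ⟨fun D₁ _ hD₁ _ => ?_, ?_⟩
  · have hM := hA₀.systemMatrix hA₁ hD₁ hB₀ lam
    refine ⟨hM.existsUnique_isBirmanSchwinger hX, hM.exists_fundamentalSolution hX,
      fun K Ψ hK hΨ => ⟨hK.isHilbertSchmidt hX hM, ?_⟩, ?_⟩
    · rw [← hexp]
      exact hK.hasDet₂ hX hM hΨ
    · exact PeriodicEvans.gammaFactor_eq_of_trace hX hA₁ fun x => by
        simp [PeriodicEvans.systemMatrix, Matrix.trace, Fintype.sum_sum_type]
  · have hM := hA₀.quasiMatrix hA₁ hB₀ lam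
    refine ⟨hM.existsUnique_isBirmanSchwinger hX, hM.exists_fundamentalSolution hX,
      fun K Ψ hK hΨ => ?_, ?_⟩
    · rw [← hexp]
      have hdet := hK.hasDet₂ hX hM hΨ
      refine ⟨hK.isHilbertSchmidt hX hM, hdet, ?_⟩
      exact (hdet.tendsto_fourierTruncation hX hM hK).congr fun J =>
        (PeriodicEvans.truncatedF_eq hX hA₀ hB₀ lam J).symm
    · exact PeriodicEvans.gammaFactor_eq_of_trace hX hA₁ fun x => by
        simp [PeriodicEvans.quasiMatrix, Matrix.trace, Fintype.sum_sum_type]
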